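/- **Setting.** There are $N\ge 1$ arms and $M\le N$ players. At time $t=1,2,\dots$ arm $n$ offers the reward $X_n(t)$; the reward vectors $(X_1(t),\dots,X_N(t))$ are independent over $t$, and for each $n$ the $X_n(t)$ are identically distributed with finite mean $\theta_n$. Let $\sigma$ be a permutation with $\theta_{\sigma(1)}\ge\dots\ge\theta_{\sigma(N)}$, and let $\theta_{\sigma(1)},\dots,\theta_{\sigma(M)}>0$. At each time each player chooses an arm from its own past choices and received rewards only. A player alone on arm $n$ receives $X_n(t)$. If several players choose arm $n$, they receive arbitrary partial rewards (of any distribution and dependence, the collision not being signalled) whose sum is at most $X_n(t)$ and each of which is at least $-K(1+|X_n(t)|)$, where $K\ge0$ is a constant ($K=0$: nonnegative partial rewards). If $Y(t)$ is the total reward received by all players at time $t$, the system regret is $$R_T=T\sum_{n=1}^M\theta_{\sigma(n)}-\mathbb E\Big[\sum_{t=1}^TY(t)\Big].$$ **Policy.** Fix thresholds $D(t)$. Time $t=1$ is an exploitation time; a time $t>1$ is an exploration time iff fewer than $D(t)$ exploration times precede it. At the $k$-th exploration time player $m$ plays arm $((k-1+o_m)\bmod N)+1$, where the offsets $o_1,\dots,o_M\in\{0,\dots,N-1\}$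 are distinct. At an exploitation time $t$ each player computes an estimate of the mean of each arm (with a fixed value when there is no observation) from its own observations of this arm at the exploration times before $t$, and ranks the arms by decreasing estimate, ties being broken by any measurable rule. For a predetermined permutation $\rho_t$ of $\{1,\dots,M\}$, player $m$ plays either (prioritized scheme) the arm of rank $\rho_t(m)$, or (fair sharing scheme) the $\rho_t(m)$-th arm, in the order of the arm indices, of the set of its $M$ highest ranked arms; all players use the same scheme. Say that $g$ is *below the gap* if, in the prioritized scheme, $g<\theta_{\sigma(i)}-\theta_{\sigma(j)}$ for all $i\le M$ and $i<j\le N$, and in the fair sharing scheme, $g<\theta_{\sigma(i)}-\theta_{\sigma(j)}$ for all $i\le M<j\le N$. Put $$E=N\sum_{n=1}^M\theta_{\sigma(n)}-M\sum_{n=1}^N\theta_n,\qquad L=\sum_{n=1}^M\theta_{\sigma(n)}+M\Big(K+(1+K)\max_n\mathbb E|X_n(1)|\Big).$$ **Theorem.** For either scheme: 1. Let $u_0,\zeta>0$ be such that for every $n$, $\mathbb E[e^{uX_n(1)}]<\infty$ for $|u|\le u_0$ and the second derivative of $u\mapsto\mathbb E[e^{u(X_n(1)-\theta_n)}]$ is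 at most $\zeta$ for $|u|<u_0$. Let $0<a\le 1/(2\zeta)$, let $c>0$ be below the gap, $\delta=\min\{c/2,\zeta u_0\}$ and $w>1/(a\delta^2)$. With $D(t)=N\lceil w\log t\rceil$ and sample means as estimates, for all $T\ge1$, $$R_T\le\lceil w\log T\rceil\,E+2MN\,L\Big(1+\frac1{a\delta^2w-1}\Big).$$ 2. Suppose that, for some $u_0>0$ and all $n$, $\mathbb E[e^{uX_n(1)}]<\infty$ for $|u|\le u_0$, and that $0$ is below the gap. Let $f$ be positive and nondecreasing with $f(t)\to\infty$. With $D(t)=N\lceil f(t)\log t\rceil$ and sample means as estimates, $|R_T|\le C f(T)\log T$ for all $T\ge2$, so $R_T=O(f(T)\log T)$. 3. Let $p>1$ with $\mathbb E|X_n(1)|^p<\infty$ for all $n$, let $v>0$, and suppose that $0$ is below the gap. Put $\alpha=1/p$ if $p\le2$ and $\alpha=1/(1+p/2)$ if $p>2$. With $D(t)=v\,t^{\alpha}$ and sample means as estimates, $|R_T|\le C\,T^{\alpha}$ for all $T\ge1$, so $R_T=O(T^\alpha)$. 4. Let $1<p\le2$ and $u>0$ with $\mathbb E|X_n(1)|^p\le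 u$ for all $n$, and put $a=4^{p/(1-p)}u^{1/(1-p)}$. Let $\delta>0$ with $2\delta$ below the gap, and $w>1/(a\delta^{p/(p-1)})$. Take $D(t)=N\lceil w\log t\rceil$ and as estimates, when $\tau$ observations $x_1,\dots,x_\tau$ of the arm (in the order of time) are available, the truncated sample means $$\frac1\tau\sum_{k=1}^{\tau}x_k\,\mathbf 1\Big\{|x_k|\le\Big(\frac{uk}{\log(\epsilon^{-1})}\Big)^{1/p}\Big\},\qquad \epsilon=\exp(-a\delta^{p/(p-1)}\tau).$$ Then for all $T\ge1$, $$R_T\le\lceil w\log T\rceil\,E+2MN\,L\Big(1+\frac1{a\delta^{p/(p-1)}w-1}\Big).$$ The constants $C$ in 2 and 3 depend neither on $T$ nor on the partial rewards received in collisions. -/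

import Mathlib

open MeasureTheory ProbabilityTheory Filter

noncomputable section

namespace DSEE

/-! ### Rewards of the arms -/

/-- `X n t` is the reward offered by arm `n` at time `t = 1, 2, …`. Over time the rewards are
independent, and those of one arm have the same, integrable, law. Rewards of different arms at the
same time may be dependent; independent arms are a special case. -/
structure IsRewardProcess {Ω : Type*} [MeasurableSpace Ω] (μ : Measure Ω) {N : ℕ}
    (X : Fin N → ℕ → Ω → ℝ) : Prop where
  measurable : ∀ n t, Measurable (X n t)
  indep : iIndepFun (fun (t : ℕ) (ω : Ω) (n : Fin N) => X n t ω) μ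
  identDistrib : ∀ n t, IdentDistrib (X n t) (X n 1) μ μ
  integrable : ∀ n, Integrable (X n 1) μ

/-- The mean reward `θ n` of arm `n`. -/
def armMean {Ω : Type*} [MeasurableSpace Ω] (μ : Measure Ω) {N : ℕ}
    (X : Fin N → ℕ → Ω → ℝ) (n : Fin N) : ℝ :=
  ∫ ω, X n 1 ω ∂μ

/-- A random variable is light-tailed (with parameter `u₀`) if its moment-generating function is
finite on `[-u₀, u₀]`. -/
def IsLightTailedOn {Ω : Type*} [MeasurableSpace Ω] (μ : Measure Ω) (Z : Ω → ℝ) (u₀ : ℝ) : Prop :=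
  ∀ u : ℝ, |u| ≤ u₀ → Integrable (fun ω => Real.exp (u * Z ω)) μ

/-- `ζ` bounds the second derivative of the moment-generating function of the centred variable
on the interval `(-u₀, u₀)`. -/
def IsMgfCurvatureBound {Ω : Type*} [MeasurableSpace Ω] (μ : Measure Ω) (Z : Ω → ℝ)
    (u₀ ζ : ℝ) : Prop :=
  ∀ u : ℝ, |u| < u₀ → iteratedDeriv 2 (mgf (fun ω => Z ω - ∫ ω', Z ω' ∂μ) μ) u ≤ ζ

/-! ### Decentralized play with collisions -/

/-- What a player has seen before time `t`: the arms it played and the rewards it received at the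
times `1, …, t - 1`. -/
abbrev History (N t : ℕ) : Type := Finset.Ico 1 t → Fin N × ℝ

/-- A local policy maps the player's own history to the arm to play. -/
abbrev LocalPolicy (N : ℕ) : Type := (t : ℕ) → History N t → Fin N

/-- `A t m` is the arm played and `Y t m` the reward received by player `m` at time `t` when all
players follow the local policies `π`. A player that is alone on its arm receives the reward of
the arm. Players that collide receive arbitrary partial rewards whose sum is at most the reward of
the arm and each of which is bounded below by `-K (1 + |reward of the arm|)`. -/
structure IsPlay {Ω : Type*} [MeasurableSpace Ω] {N M : ℕ} (X : Fin N → ℕ → Ω → ℝ)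
    (π : Fin M → LocalPolicy N) (K : ℝ) (A : ℕ → Fin M → Ω → Fin N) (Y : ℕ → Fin M → Ω → ℝ) :
    Prop where
  measurable : ∀ t m, Measurable (Y t m)
  decision : ∀ t, 1 ≤ t → ∀ m ω,
    A t m ω = π m t (fun s => (A s m ω, Y s m ω))
  alone : ∀ t, 1 ≤ t → ∀ m ω, (∀ m', m' ≠ m → A t m' ω ≠ A t m ω) →
    Y t m ω = X (A t m ω) t ω
  collision_sum_le : ∀ t, 1 ≤ t → ∀ n ω, (∃ m m', m ≠ m' ∧ A t m ω = n ∧ A t m' ω = n) →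
    ∑ m with A t m ω = n, Y t m ω ≤ X n t ω
  collision_ge : ∀ t, 1 ≤ t → ∀ m ω, (∃ m', m' ≠ m ∧ A t m' ω = A t m ω) →
    -(K * (1 + |X (A t m ω) t ω|)) ≤ Y t m ω

/-- The system regret up to time `T`: `T` times the sum of the `M` largest means minus the expected
total reward of all players. Here `σ` lists the arms by decreasing mean. -/
def systemRegret {Ω : Type*} [MeasurableSpace Ω] (μ : Measure Ω) {N M : ℕ} (hMN : M ≤ N)
    (X : Fin N → ℕ → Ω → ℝ) (σ : Equiv.Perm (Fin N)) (Y : ℕ → Fin M → Ω → ℝ) (T : ℕ) : ℝ :=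
  T * ∑ k : Fin M, armMean μ X (σ (Fin.castLE hMN k))
    - ∫ ω, ∑ t ∈ Finset.Icc 1 T, ∑ m, Y t m ω ∂μ

/-- The rewards received are integrable, so the regret is not a junk value. -/
theorem IsPlay.integrable {Ω : Type*} [MeasurableSpace Ω] {μ : Measure Ω} [IsProbabilityMeasure μ]
    {N M : ℕ} {X : Fin N → ℕ → Ω → ℝ} (hX : IsRewardProcess μ X) {π : Fin M → LocalPolicy N}
    {K : ℝ} (hK : 0 ≤ K) {A : ℕ → Fin M → Ω → Fin N} {Y : ℕ → Fin M → Ω → ℝ}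
    (h : IsPlay X π K A Y) (t : ℕ) (ht : 1 ≤ t) (m : Fin M) : Integrable (Y t m) μ := by
  have hXi : ∀ n, Integrable (X n t) μ := fun n =>
    ((hX.identDistrib n t).integrable_iff).2 (hX.integrable n)
  have hS : Integrable (fun ω => ∑ n, |X n t ω|) μ :=
    integrable_finsetSum _ fun n _ => (hXi n).abs
  have hB : Integrable (fun ω => (1 + (M + 1) * K) * (1 + ∑ n, |X n t ω|)) μ :=
    ((integrable_const (1 : ℝ)).add hS).const_mul _
  refine hB.mono' (h.measurable t m).aestronglyMeasurable (Eventually.of_forall fun ω => ?_)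
  have hx : |X (A t m ω) t ω| ≤ ∑ n, |X n t ω| :=
    Finset.single_le_sum (f := fun n => |X n t ω|) (fun _ _ => abs_nonneg _) (Finset.mem_univ _)
  have hM : (0 : ℝ) ≤ M := Nat.cast_nonneg M
  have hx0 := abs_nonneg (X (A t m ω) t ω)
  have hKS : K * (1 + |X (A t m ω) t ω|) ≤ K * (1 + ∑ n, |X n t ω|) := by gcongr
  have hKS0 : 0 ≤ K * (1 + ∑ n, |X n t ω|) := le_trans (by positivity) hKS
  have hMKS0 := mul_nonneg hM hKS0
  rw [Real.norm_eq_abs]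
  by_cases hc : ∃ m', m' ≠ m ∧ A t m' ω = A t m ω
  · have hlow := h.collision_ge t ht m ω hc
    obtain ⟨m', hne, heq⟩ := hc
    have hsum := h.collision_sum_le t ht (A t m ω) ω ⟨m', m, hne, heq, rfl⟩
    have hmem : m ∈ Finset.univ.filter (fun j => A t j ω = A t m ω) := by simp
    rw [← Finset.add_sum_erase _ _ hmem] at hsum
    have hrest : -(M * (K * (1 + ∑ n, |X n t ω|))) ≤
        ∑ j ∈ (Finset.univ.filter (fun j => A t j ω = A t m ω)).erase m, Y t j ω := by
      have h1 : ∀ j ∈ (Finset.univ.filter (fun j => A t j ω = A t m ω)).erase m,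
          -(K * (1 + ∑ n, |X n t ω|)) ≤ Y t j ω := by
        intro j hj
        simp only [Finset.mem_erase, Finset.mem_filter, Finset.mem_univ, true_and] at hj
        have := h.collision_ge t ht j ω ⟨m, hj.1.symm, hj.2.symm⟩
        rw [hj.2] at this
        linarith
      have h2 := Finset.card_nsmul_le_sum _ _ _ h1
      have h3 : ((Finset.univ.filter (fun j => A t j ω = A t m ω)).erase m).card ≤ M := by
        simpa using Finset.card_le_univ
          ((Finset.univ.filter (fun j => A t j ω = A t m ω)).erase m)
      rw [nsmul_eq_mul] at h2
      have h4 : (((Finset.univ.filter (fun j => A t j ω = A t m ω)).erase m).card : ℝ) ≤ M := by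
        exact_mod_cast h3
      nlinarith [mul_le_mul_of_nonneg_right h4 hKS0]
    have := le_abs_self (X (A t m ω) t ω)
    rw [abs_le]
    constructor <;> nlinarith
  · push Not at hc
    rw [h.alone t ht m ω hc]
    nlinarith

/-! ### The exploration sequence -/

/-- The set of exploration times up to time `t`, when a time `t > 1` is included if and only if
fewer than `D t` times have been included before it. -/
def explSeq (D : ℕ → ℝ) : ℕ → Finset ℕ
  | 0 => ∅
  | t + 1 =>
    if 1 < t + 1 ∧ ((explSeq D t).card : ℝ) < D (t + 1) then insert (t + 1) (explSeq D t)
    else explSeq D t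

/-- Round-robin exploration: at the `k`-th exploration time, player `m` plays arm
`(k - 1 + offset of m) mod N`. -/
def explArm {N M : ℕ} [NeZero N] (D : ℕ → ℝ) (o : Fin M → Fin N) (m : Fin M) (t : ℕ) : Fin N :=
  Fin.ofNat N ((explSeq D t).card - 1 + (o m : ℕ))

/-- The exploration times before `t` at which player `m` plays arm `n`. -/
def obsTimes {N M : ℕ} [NeZero N] (D : ℕ → ℝ) (o : Fin M → Fin N) (m : Fin M) (n : Fin N)
    (t : ℕ) : Finset ℕ :=
  (explSeq D (t - 1)).filter (fun s => explArm D o m s = n)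

/-! ### Estimators of the mean of an arm

An estimator takes the set `S` of observation times of the arm and the record `z` of the rewards
received by the player. -/

/-- The sample mean. -/
def sampleMean (S : Finset ℕ) (z : ℕ → ℝ) : ℝ :=
  (∑ s ∈ S, z s) / S.card

/-- The truncation parameter `ε = exp (-a δ^(p/(p-1)) τ)` after `τ` observations. -/
def truncEps (p a δ : ℝ) (τ : ℕ) : ℝ :=
  Real.exp (-(a * δ ^ (p / (p - 1)) * τ))

/-- The truncated sample mean: the `k`-th observation is kept if its absolute value is at most
`(u k / log (1/ε))^(1/p)`. The observation at time `s` is number `#{r ∈ S | r ≤ s}`. -/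
def truncMean (p u a δ : ℝ) (S : Finset ℕ) (z : ℕ → ℝ) : ℝ :=
  (∑ s ∈ S,
    if |z s| ≤ (u * ((S.filter (fun r => r ≤ s)).card : ℝ)
        / Real.log (truncEps p a δ S.card)⁻¹) ^ (1 / p)
    then z s else 0) / S.card

/-! ### Exploitation -/

/-- The two ways in which the players share the `M` arms with the largest estimates. -/
inductive Scheme
  | prioritized
  | fairSharing

/-- A rule by which players rank the arms by decreasing estimate: `R t m v k` is the arm of rank `k`
(counted from `0`) according to player `m` at time `t` if its estimates are `v`. Ties are broken in
an arbitrary measurable way, which may depend on the player and on time. -/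
structure IsRankingRule {N M : ℕ} (R : ℕ → Fin M → (Fin N → ℝ) → Equiv.Perm (Fin N)) : Prop where
  measurable : ∀ t m k, Measurable (fun v => R t m v k)
  antitone : ∀ t m v, Antitone (v ∘ R t m v)

/-- The set of the first `M` arms of a ranking. -/
def topArms {N M : ℕ} (hMN : M ≤ N) (r : Equiv.Perm (Fin N)) : Finset (Fin N) :=
  (Finset.univ : Finset (Fin M)).map ((Fin.castLEEmb hMN).trans r.toEmbedding)

theorem card_topArms {N M : ℕ} (hMN : M ≤ N) (r : Equiv.Perm (Fin N)) :
    (topArms hMN r).card = M := by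
  simp [topArms]

/-- The arm to exploit for a player with ranking `r` whose current turn is `j`. In the prioritized
scheme it is the arm of rank `j`; in the fair sharing scheme it is the `j`-th element, in the common
order of the arm indices, of the set of the `M` highest ranked arms. -/
def exploitArm {N M : ℕ} (hMN : M ≤ N) (r : Equiv.Perm (Fin N)) (j : Fin M) : Scheme → Fin N
  | Scheme.prioritized => r (Fin.castLE hMN j)
  | Scheme.fairSharing => (topArms hMN r).orderEmbOfFin (card_topArms hMN r) j

/-- The rewards in a history, as a function of time. -/
def rewardRecord {N t : ℕ} (h : History N t) (s : ℕ) : ℝ :=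
  if hs : s ∈ Finset.Ico 1 t then (h ⟨s, hs⟩).2 else 0

/-- The local policy of player `m` in the decentralized DSEE policy with exploration thresholds `D`,
estimator `est`, offsets `o`, turns `ρ` and ranking rule `R`. -/
def policy {N M : ℕ} [NeZero N] (hMN : M ≤ N) (sch : Scheme) (o : Fin M → Fin N)
    (ρ : ℕ → Equiv.Perm (Fin M)) (R : ℕ → Fin M → (Fin N → ℝ) → Equiv.Perm (Fin N))
    (D : ℕ → ℝ) (est : Finset ℕ → (ℕ → ℝ) → ℝ) (m : Fin M) : LocalPolicy N :=
  fun t h =>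
    if t ∈ explSeq D t then explArm D o m t
    else exploitArm hMN (R t m (fun n => est (obsTimes D o m n t) (rewardRecord h))) (ρ t m) sch

/-- `g` is smaller than the differences of means that the scheme has to resolve, for means `θ`
listed in decreasing order by `σ`: in the prioritized scheme, the differences between each of the
`M` best arms and all arms of lower rank; in the fair sharing scheme, those between the `M` best
arms and the other arms. -/
def IsBelowGap {N : ℕ} (M : ℕ) (θ : Fin N → ℝ) (σ : Equiv.Perm (Fin N)) (g : ℝ) : Scheme → Prop
  | Scheme.prioritized => ∀ i j : Fin N, (i : ℕ) < M → i < j → g < θ (σ i) - θ (σ j)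
  | Scheme.fairSharing => ∀ i j : Fin N, (i : ℕ) < M → M ≤ (j : ℕ) → g < θ (σ i) - θ (σ j)

/-! ### Constants in the bounds -/

/-- The loss in one round of `N` exploration times, in which every player plays every arm once. -/
def explLoss {Ω : Type*} [MeasurableSpace Ω] (μ : Measure Ω) {N M : ℕ} (hMN : M ≤ N)
    (X : Fin N → ℕ → Ω → ℝ) (σ : Equiv.Perm (Fin N)) : ℝ :=
  N * ∑ k : Fin M, armMean μ X (σ (Fin.castLE hMN k)) - M * ∑ n, armMean μ X n

/-- A bound on the loss in one step in which collisions may occur. -/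
def stepLoss {Ω : Type*} [MeasurableSpace Ω] (μ : Measure Ω) {N M : ℕ} (hMN : M ≤ N)
    (X : Fin N → ℕ → Ω → ℝ) (σ : Equiv.Perm (Fin N)) (K : ℝ) : ℝ :=
  ∑ k : Fin M, armMean μ X (σ (Fin.castLE hMN k))
    + M * (K + (1 + K) * ⨆ n, ∫ ω, |X n 1 ω| ∂μ)

/-- The exponent of the regret for heavy-tailed rewards with a finite `p`-th moment. -/
def heavyExponent (p : ℝ) : ℝ :=
  if p ≤ 2 then 1 / p else 1 / (1 + p / 2)

end DSEE

end

/-!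
A player that explores is never disturbed: the offsets are distinct, so at every exploration time
the players are on different arms and observe the rewards of the arms themselves. Exploration times
are deterministic, so all decisions of all players are functions of past rewards of the arms
(`IsPlay.arm_eq_armDecision`), and are independent of the present rewards (`indepFun_past`). The
regret can therefore be examined one step at a time.

* No step has negative expected loss (`IsPlay.integral_reward_le`): a collision pays at most the
  reward of one arm, and no set of at most `M` arms beats the top `M`, whose means are positive. So
  the absolute value of the regret is the regret.
* In `N` consecutive exploration steps every player plays every arm once; with at most `N q`
  exploration steps, their loss is at most `q` times `explLoss` (`sum_explLoss_le`).
* At an exploitation time, if all estimates are within `δ` of the means and `2 δ` does not exceed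
  the gap to be resolved, all players find the right arms (`exploitArm_eq`) and nothing is lost on
  average; otherwise the loss is at most `stepLoss` (`IsPlay.le_integral_reward`). At an
  exploitation time `t` every player has observed every arm about `D t / N` times, so the
  probability of a bad estimate is controlled by the tail of an average of that many independent
  rewards.

`IsPlay.systemRegret_le` combines these. What remains is one tail bound per estimator, each by
Chernoff's method. Light tails make the centred moment-generating function at most
`exp (ζ u² / 2)`, by Taylor's formula (`sampleMean_lightTail`). For the truncated sample mean, the
parameter `1 / B`, with `B` the largest truncation level, gives exactly the error probability `ε`
(`truncMean_tail`). For the sample mean of `τ` variables with a finite `p`-th moment, truncation at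
a suitable multiple of `τ` yields the tail `C τ^(1-p)` for all `p > 1` (`sampleMean_heavyTail`), which
suffices for both forms of the exponent of the regret.
-/

namespace DSEE

/-! ### Sums of powers -/

/-- Comparison of a term of `∑ k^(α-1)` with an increment of `x^α / α`, by the mean value theorem.
Negative `α` is allowed away from `0`, so that convergent sums are covered as well. -/
theorem rpow_sub_one_le_slope {α : ℝ} (hα : α ≤ 1) (h0 : α ≠ 0) (n : ℕ) (h : 0 < α ∨ 1 ≤ n) :
    ((n : ℝ) + 1) ^ (α - 1) ≤ (((n : ℝ) + 1) ^ α - (n : ℝ) ^ α) / α := by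
  have hn : (0 : ℝ) ≤ n := Nat.cast_nonneg n
  have hpos : ∀ x ∈ Set.Icc (n : ℝ) (n + 1), x ≠ 0 ∨ 0 ≤ α := by
    intro x hx
    rcases h with h | h
    · exact Or.inr h.le
    · have : (1 : ℝ) ≤ n := by exact_mod_cast h
      exact Or.inl (by linarith [hx.1])
  obtain ⟨ξ, hξ, he⟩ := exists_hasDerivAt_eq_slope (fun x : ℝ => x ^ α)
    (fun x => α * x ^ (α - 1)) (show (n : ℝ) < n + 1 by linarith)
    (fun x hx => (Real.continuousAt_rpow_const x α (hpos x hx)).continuousWithinAt)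
    (fun x hx => Real.hasDerivAt_rpow_const (Or.inl (by linarith [hx.1])))
  have he' : ((n : ℝ) + 1) ^ α - (n : ℝ) ^ α = α * ξ ^ (α - 1) := by
    rw [he]; simp
  rw [he', mul_div_cancel_left₀ _ h0]
  exact Real.rpow_le_rpow_of_nonpos (by linarith [hξ.1]) hξ.2.le (by linarith)

theorem sum_rpow_sub_one_le {α : ℝ} (hα : 0 < α) (hα1 : α ≤ 1) (T : ℕ) :
    ∑ t ∈ Finset.Icc 1 T, (t : ℝ) ^ (α - 1) ≤ (T : ℝ) ^ α / α := by
  induction T with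
  | zero => simp [Real.zero_rpow hα.ne']
  | succ T ih =>
    rw [Finset.sum_Icc_succ_top (by omega)]
    have := rpow_sub_one_le_slope hα1 hα.ne' T (Or.inl hα)
    push_cast
    rw [sub_div] at this
    linarith

theorem sum_rpow_neg_le {s : ℝ} (hs : 1 < s) (T : ℕ) :
    ∑ t ∈ Finset.Icc 1 T, (t : ℝ) ^ (-s) ≤ 1 + 1 / (s - 1) := by
  have hs0 : 0 < s - 1 := by linarith
  rcases Nat.eq_zero_or_pos T with rfl | hT
  · simp; positivity
  have key : ∑ t ∈ Finset.Icc 1 T, (t : ℝ) ^ (-s) ≤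
      1 + (1 - (T : ℝ) ^ (1 - s)) / (s - 1) := by
    induction T, hT using Nat.le_induction with
    | base => simp
    | succ T hT ih =>
      rw [Finset.sum_Icc_succ_top (by omega)]
      have := rpow_sub_one_le_slope (α := 1 - s) (by linarith) (by linarith) T (Or.inr hT)
      rw [show 1 - s - 1 = -s by ring, show 1 - s = -(s - 1) by ring, div_neg, sub_div] at this
      push_cast
      rw [sub_div] at ih ⊢
      rw [show 1 - s = -(s - 1) by ring] at ih ⊢
      linarith
  refine key.trans ?_
  gcongr
  have : (0 : ℝ) ≤ (T : ℝ) ^ (1 - s) := by positivity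
  linarith

/-! ### The arms of largest mean -/

theorem mem_topArms {N M : ℕ} (hMN : M ≤ N) (r : Equiv.Perm (Fin N)) (n : Fin N) :
    n ∈ topArms hMN r ↔ (r.symm n : ℕ) < M := by
  simp only [topArms, Finset.mem_map, Finset.mem_univ, true_and, Function.Embedding.trans_apply,
    Equiv.coe_toEmbedding, Fin.castLEEmb_apply]
  constructor
  · rintro ⟨k, rfl⟩
    simp
  · intro h
    exact ⟨⟨_, h⟩, by simp⟩

theorem sum_topArms {N M : ℕ} (hMN : M ≤ N) (r : Equiv.Perm (Fin N)) (f : Fin N → ℝ) :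
    ∑ n ∈ topArms hMN r, f n = ∑ k : Fin M, f (r (Fin.castLE hMN k)) := by
  simp [topArms, Finset.sum_map]

/-- No set of at most `M` arms has a larger sum of means than the top `M` arms. -/
theorem sum_le_sum_top {N M : ℕ} (hMN : M ≤ N) {θ : Fin N → ℝ} {σ : Equiv.Perm (Fin N)}
    (hσ : Antitone (θ ∘ σ)) (hpos : ∀ k : Fin M, 0 < θ (σ (Fin.castLE hMN k)))
    (S : Finset (Fin N)) (hS : S.card ≤ M) :
    ∑ n ∈ S, θ n ≤ ∑ k : Fin M, θ (σ (Fin.castLE hMN k)) := by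
  rcases Nat.eq_zero_or_pos M with rfl | hM
  · have : S = ∅ := Finset.card_eq_zero.mp (by omega)
    simp [this]
  -- The smallest of the `M` largest means serves as a threshold.
  set c := θ (σ (Fin.castLE hMN ⟨M - 1, by omega⟩)) with hc
  have hc0 : 0 < c := hpos _
  have h1 : ∑ n ∈ S, (θ n - c) ≤ ∑ n ∈ topArms hMN σ, (θ n - c) := by
    have hin : ∀ n ∈ topArms hMN σ, 0 ≤ θ n - c := by
      intro n hn
      rw [mem_topArms] at hn
      have := hσ (show σ.symm n ≤ Fin.castLE hMN ⟨M - 1, by omega⟩ by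
        rw [Fin.le_def]; simp; omega)
      simp only [Function.comp, Equiv.apply_symm_apply] at this
      linarith
    have hout : ∀ n, n ∉ topArms hMN σ → θ n - c ≤ 0 := by
      intro n hn
      rw [mem_topArms] at hn
      have := hσ (show Fin.castLE hMN ⟨M - 1, by omega⟩ ≤ σ.symm n by
        rw [Fin.le_def]; simp; omega)
      simp only [Function.comp, Equiv.apply_symm_apply] at this
      linarith
    calc ∑ n ∈ S, (θ n - c) ≤ ∑ n ∈ S with n ∈ topArms hMN σ, (θ n - c) := by
          rw [Finset.sum_filter]
          refine Finset.sum_le_sum fun n _ => ?_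
          split_ifs with h
          · exact le_rfl
          · exact hout n h
      _ ≤ ∑ n ∈ topArms hMN σ, (θ n - c) := by
          refine Finset.sum_le_sum_of_subset_of_nonneg ?_ fun n hn _ => hin n hn
          intro n hn
          exact (Finset.mem_filter.mp hn).2
  simp only [Finset.sum_sub_distrib, Finset.sum_const, card_topArms, nsmul_eq_mul] at h1
  rw [sum_topArms] at h1
  have : (S.card : ℝ) * c ≤ M * c := by gcongr
  linarith

/-! ### Correct rankings -/

/-- If the estimates are so accurate that they resolve the gaps between the `k` best arms and the
others, then the `k` highest ranked arms are the `k` best arms. -/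
theorem rank_lt_iff {N : ℕ} {θ v : Fin N → ℝ} {σ r : Equiv.Perm (Fin N)} {δ : ℝ} {k : ℕ}
    (hv : ∀ n, |v n - θ n| ≤ δ) (hr : Antitone (v ∘ r))
    (hgap : ∀ i j : Fin N, (i : ℕ) < k → k ≤ (j : ℕ) → 2 * δ < θ (σ i) - θ (σ j)) (hk : k ≤ N)
    (n : Fin N) : (r.symm n : ℕ) < k ↔ (σ.symm n : ℕ) < k := by
  simp only [← mem_topArms hk]
  suffices h : topArms hk σ ⊆ topArms hk r by
    rw [Finset.eq_of_subset_of_card_le h (by simp [card_topArms])]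
  intro i hi
  by_contra hi'
  have hne : ¬ topArms hk r ⊆ topArms hk σ := by
    intro hsub
    rw [Finset.eq_of_subset_of_card_le hsub (by simp [card_topArms])] at hi'
    exact hi' hi
  obtain ⟨j, hj, hj'⟩ := Finset.not_subset.mp hne
  rw [mem_topArms] at hi hi' hj hj'
  have h1 := hgap (σ.symm i) (σ.symm j) hi (by omega)
  have h2 := hr (show r.symm j ≤ r.symm i by rw [Fin.le_def]; omega)
  simp only [Function.comp, Equiv.apply_symm_apply] at h1 h2
  have := abs_le.mp (hv i)
  have := abs_le.mp (hv j)
  linarith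

/-- With accurate estimates the players exploit as if they knew the means. -/
theorem exploitArm_eq {N M : ℕ} (hMN : M ≤ N) {θ v : Fin N → ℝ} {σ r : Equiv.Perm (Fin N)}
    {δ g : ℝ} {sch : Scheme} (hv : ∀ n, |v n - θ n| ≤ δ) (hr : Antitone (v ∘ r))
    (hg : 2 * δ ≤ g) (hgap : IsBelowGap M θ σ g sch) (j : Fin M) :
    exploitArm hMN r j sch = exploitArm hMN σ j sch := by
  cases sch with
  | prioritized =>
    simp only [exploitArm]
    set i := Fin.castLE hMN j
    have hi : (i : ℕ) < M := j.2
    have key : ∀ k, k ≤ M → ((r.symm (σ i) : ℕ) < k ↔ (i : ℕ) < k) := by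
      intro k hk
      rw [rank_lt_iff hv hr (k := k) (σ := σ) ?_ (hk.trans hMN), Equiv.symm_apply_apply]
      intro i' j' hi' hj'
      exact hg.trans_lt (hgap i' j' (by omega) (by rw [Fin.lt_def]; omega))
    have h1 := (key (i + 1) hi).2 (by omega)
    have h2 := (key i hi.le).not.2 (by omega)
    have h3 : r.symm (σ i) = i := Fin.ext (by omega)
    exact ((Equiv.symm_apply_eq r).1 h3).symm
  | fairSharing =>
    have h : topArms hMN r = topArms hMN σ := by
      ext n
      rw [mem_topArms, mem_topArms]
      exact rank_lt_iff hv hr (fun i j hi hj => hg.trans_lt (hgap i j hi hj)) hMN n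
    simp only [exploitArm]
    congr 1
    simp only [h]

theorem exploitArm_injective {N M : ℕ} (hMN : M ≤ N) (r : Equiv.Perm (Fin N)) (sch : Scheme) :
    Function.Injective fun j => exploitArm hMN r j sch := by
  cases sch with
  | prioritized => exact r.injective.comp (Fin.castLE_injective hMN)
  | fairSharing => exact ((topArms hMN r).orderEmbOfFin (card_topArms hMN r)).injective

/-- In either scheme, the players with the common ranking `r` occupy exactly its top `M` arms. -/
theorem sum_exploitArm {N M : ℕ} (hMN : M ≤ N) (r : Equiv.Perm (Fin N)) (sch : Scheme)
    (f : Fin N → ℝ) :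
    ∑ j, f (exploitArm hMN r j sch) = ∑ k : Fin M, f (r (Fin.castLE hMN k)) := by
  cases sch with
  | prioritized => rfl
  | fairSharing =>
    rw [← sum_topArms hMN r f]
    refine (Finset.sum_map Finset.univ
      ((topArms hMN r).orderEmbOfFin (card_topArms hMN r)).toEmbedding f).symm.trans ?_
    congr 1
    exact Finset.map_orderEmbOfFin_univ _ _

/-- There are finitely many gaps, so positive gaps are bounded below by a positive constant. -/
theorem IsBelowGap.exists_pos {N M : ℕ} {θ : Fin N → ℝ} {σ : Equiv.Perm (Fin N)} {sch : Scheme}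
    (h : IsBelowGap M θ σ 0 sch) : ∃ c, 0 < c ∧ IsBelowGap M θ σ c sch := by
  classical
  have key : ∀ P : Fin N × Fin N → Prop, (∀ x, P x → 0 < θ (σ x.1) - θ (σ x.2)) →
      ∃ c, 0 < c ∧ ∀ x, P x → c < θ (σ x.1) - θ (σ x.2) := by
    intro P hP
    have h1 : ∀ x, ∀ᶠ c in nhdsWithin (0 : ℝ) (Set.Ioi 0), P x → c < θ (σ x.1) - θ (σ x.2) := by
      intro x
      by_cases hx : P x
      · filter_upwards [Ioo_mem_nhdsGT (hP x hx)] with c hc _ using hc.2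
      · exact Eventually.of_forall fun c h => absurd h hx
    obtain ⟨c, hc, hc0⟩ := ((eventually_all.2 h1).and self_mem_nhdsWithin).exists
    exact ⟨c, hc0, hc⟩
  cases sch with
  | prioritized =>
    obtain ⟨c, hc, hc'⟩ := key (fun x => (x.1 : ℕ) < M ∧ x.1 < x.2) fun x hx => h _ _ hx.1 hx.2
    exact ⟨c, hc, fun i j hi hj => hc' (i, j) ⟨hi, hj⟩⟩
  | fairSharing =>
    obtain ⟨c, hc, hc'⟩ := key (fun x => (x.1 : ℕ) < M ∧ M ≤ (x.2 : ℕ)) fun x hx => h _ _ hx.1 hx.2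
    exact ⟨c, hc, fun i j hi hj => hc' (i, j) ⟨hi, hj⟩⟩

/-! ### The exploration sequence -/

theorem explSeq_subset_succ (D : ℕ → ℝ) (t : ℕ) : explSeq D t ⊆ explSeq D (t + 1) := by
  rw [explSeq]
  split_ifs
  · exact Finset.subset_insert _ _
  · exact subset_rfl

theorem explSeq_mono (D : ℕ → ℝ) : Monotone (explSeq D) :=
  monotone_nat_of_le_succ (explSeq_subset_succ D)

theorem explSeq_subset (D : ℕ → ℝ) (t : ℕ) : explSeq D t ⊆ Finset.Ioc 1 t := by
  induction t with
  | zero => simp [explSeq]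
  | succ t ih =>
    have h2 : explSeq D t ⊆ Finset.Ioc 1 (t + 1) :=
      ih.trans (Finset.Ioc_subset_Ioc_right (Nat.le_succ t))
    rw [explSeq]
    split_ifs with h
    · refine Finset.insert_subset ?_ h2
      simp; omega
    · exact h2

theorem mem_explSeq_iff (D : ℕ → ℝ) {s t : ℕ} (hst : s ≤ t) :
    s ∈ explSeq D t ↔ s ∈ explSeq D s := by
  refine ⟨fun h => ?_, fun h => explSeq_mono D hst h⟩
  induction t, hst using Nat.le_induction with
  | base => exact h
  | succ t hst ih =>
    rw [explSeq] at h
    split_ifs at h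
    · rcases Finset.mem_insert.1 h with h | h
      · omega
      · exact ih h
    · exact ih h

theorem explSeq_succ_of_mem (D : ℕ → ℝ) {t : ℕ} (h : t + 1 ∈ explSeq D (t + 1)) :
    explSeq D (t + 1) = insert (t + 1) (explSeq D t) ∧ t + 1 ∉ explSeq D t ∧
      ((explSeq D t).card : ℝ) < D (t + 1) := by
  have hn : t + 1 ∉ explSeq D t := fun h' => by
    have := Finset.mem_Ioc.1 (explSeq_subset D t h'); omega
  by_cases hc : 1 < t + 1 ∧ ((explSeq D t).card : ℝ) < D (t + 1)
  · exact ⟨by rw [explSeq, if_pos hc], hn, hc.2⟩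
  · rw [explSeq, if_neg hc] at h
    exact absurd h hn

theorem explSeq_succ_of_notMem (D : ℕ → ℝ) {t : ℕ} (h : t + 1 ∉ explSeq D (t + 1)) :
    explSeq D (t + 1) = explSeq D t ∧ (1 ≤ t → D (t + 1) ≤ (explSeq D t).card) := by
  by_cases hc : 1 < t + 1 ∧ ((explSeq D t).card : ℝ) < D (t + 1)
  · rw [explSeq, if_pos hc] at h
    exact absurd (Finset.mem_insert_self _ _) h
  · refine ⟨by rw [explSeq, if_neg hc], fun ht => ?_⟩
    push Not at hc
    exact hc (by omega)

/-- The `k`-th exploration time is the one with `(explSeq D t).card = k`. -/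
theorem sum_explSeq {α : Type*} [AddCommMonoid α] (D : ℕ → ℝ) (g : ℕ → α) (T : ℕ) :
    ∑ t ∈ explSeq D T, g ((explSeq D t).card - 1) = ∑ k ∈ Finset.range (explSeq D T).card, g k := by
  induction T with
  | zero => simp [explSeq]
  | succ T ih =>
    by_cases h : T + 1 ∈ explSeq D (T + 1)
    · obtain ⟨h1, h2, -⟩ := explSeq_succ_of_mem D h
      have hc : (explSeq D (T + 1)).card = (explSeq D T).card + 1 := by
        rw [h1, Finset.card_insert_of_notMem h2]
      rw [hc, Finset.sum_range_succ, ← ih]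
      conv_lhs => rw [h1]
      rw [Finset.sum_insert h2, hc, add_comm, Nat.add_sub_cancel]
    · rw [(explSeq_succ_of_notMem D h).1, ih]

/-- An exploration time is added only while the count is below the threshold, so the count exceeds a
bound `B` of the thresholds by less than `1`. -/
theorem card_explSeq_lt {D : ℕ → ℝ} {T : ℕ} {B : ℝ} (hB : ∀ t, 1 < t → t ≤ T → D t ≤ B)
    (hB0 : 0 ≤ B) : ((explSeq D T).card : ℝ) < B + 1 := by
  induction T with
  | zero => simp [explSeq]; linarith
  | succ T ih =>
    have ih' := ih fun t h1 h2 => hB t h1 (by omega)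
    by_cases h : T + 1 ∈ explSeq D (T + 1)
    · obtain ⟨h1, h2, h3⟩ := explSeq_succ_of_mem D h
      rw [h1, Finset.card_insert_of_notMem h2]
      push_cast
      have := Finset.mem_Ioc.1 (explSeq_subset D _ h)
      linarith [hB (T + 1) this.1 le_rfl]
    · rwa [(explSeq_succ_of_notMem D h).1]

theorem card_explSeq_le {D : ℕ → ℝ} {T q : ℕ} (hB : ∀ t, 1 < t → t ≤ T → D t ≤ q) :
    (explSeq D T).card ≤ q := by
  have := card_explSeq_lt hB (Nat.cast_nonneg q)
  have : (explSeq D T).card < q + 1 := by exact_mod_cast this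
  omega

/-! ### Round-robin play -/

/-- In `q` complete rounds of `N` steps each arm is visited `q` times, whatever the offset. -/
theorem sum_range_round {α : Type*} [AddCommMonoid α] (N : ℕ) [NeZero N] (h : Fin N → α)
    (o q : ℕ) :
    ∑ k ∈ Finset.range (N * q), h (Fin.ofNat N (k + o)) = q • ∑ n, h n := by
  induction q with
  | zero => simp
  | succ q ih =>
    rw [Nat.mul_succ, Finset.sum_range_add, ih, succ_nsmul]
    congr 1
    rw [Finset.sum_range]
    refine Fintype.sum_bijective (fun i : Fin N => i + Fin.ofNat N o)
      (Equiv.addRight (Fin.ofNat N o)).bijective _ _ fun i => ?_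
    congr 1
    ext
    simp [Fin.val_add, Fin.ofNat, add_assoc]

theorem injective_round {N M : ℕ} [NeZero N] {o : Fin M → Fin N} (ho : Function.Injective o)
    (k : ℕ) : Function.Injective fun m => Fin.ofNat N (k + (o m : ℕ)) := by
  intro m m' h
  refine ho (add_left_cancel (a := Fin.ofNat N k) ?_)
  have e : ∀ x : Fin N, Fin.ofNat N k + x = Fin.ofNat N (k + (x : ℕ)) := by
    intro x; ext; simp [Fin.val_add, Fin.ofNat]
  rw [e, e]
  exact h

/-- After `N q` exploration times, each player has observed each arm at least `q` times. -/
theorem le_card_obsTimes {N M : ℕ} [NeZero N] {D : ℕ → ℝ} (o : Fin M → Fin N) (m : Fin M)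
    (n : Fin N) {t q : ℕ} (h : N * q ≤ (explSeq D (t - 1)).card) :
    q ≤ (obsTimes D o m n t).card := by
  rw [obsTimes, Finset.card_filter]
  refine le_of_le_of_eq ?_
    (sum_explSeq D (fun k => if Fin.ofNat N (k + (o m : ℕ)) = n then 1 else 0) (t - 1)).symm
  calc q = ∑ k ∈ Finset.range (N * q), if Fin.ofNat N (k + (o m : ℕ)) = n then 1 else 0 := by
        rw [sum_range_round N (fun i => if i = n then 1 else 0)]
        simp
    _ ≤ _ := by
        refine Finset.sum_le_sum_of_subset ?_
        simpa using h

/-- The loss of the exploration steps, relative to knowing the best arms, is at most that of `q`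
complete rounds. -/
theorem sum_explLoss_le {N M : ℕ} [NeZero N] (hMN : M ≤ N) {θ : Fin N → ℝ}
    {σ : Equiv.Perm (Fin N)} (hσ : Antitone (θ ∘ σ))
    (hpos : ∀ k : Fin M, 0 < θ (σ (Fin.castLE hMN k))) {o : Fin M → Fin N}
    (ho : Function.Injective o) (D : ℕ → ℝ) {T q : ℕ} (hq : (explSeq D T).card ≤ N * q) :
    ∑ t ∈ explSeq D T,
        (∑ k : Fin M, θ (σ (Fin.castLE hMN k)) - ∑ m, θ (explArm D o m t)) ≤
      q * (N * ∑ k : Fin M, θ (σ (Fin.castLE hMN k)) - M * ∑ n, θ n) := by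
  set Θ := ∑ k : Fin M, θ (σ (Fin.castLE hMN k)) with hΘ
  simp only [explArm]
  rw [sum_explSeq D (fun k => Θ - ∑ m, θ (Fin.ofNat N (k + (o m : ℕ))))]
  calc _ ≤ ∑ k ∈ Finset.range (N * q), (Θ - ∑ m, θ (Fin.ofNat N (k + (o m : ℕ)))) := by
        -- Each step has a nonnegative loss, so an incomplete last round may be completed.
        refine Finset.sum_le_sum_of_subset_of_nonneg (by simpa using hq) fun k _ _ => ?_
        have := sum_le_sum_top hMN hσ hpos
          (Finset.univ.map ⟨fun m => Fin.ofNat N (k + (o m : ℕ)), injective_round ho k⟩) (by simp)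
        rw [Finset.sum_map] at this
        exact sub_nonneg.2 this
    _ = _ := by
        have h : ∑ k ∈ Finset.range (N * q), ∑ m, θ (Fin.ofNat N (k + (o m : ℕ))) =
            M * (q * ∑ n, θ n) := by
          rw [Finset.sum_comm]
          simp only [sum_range_round N θ]
          simp
        rw [Finset.sum_sub_distrib, h]
        simp
        ring

/-! ### Estimators, past rewards and decisions -/

/-- What an analysis of the policy needs to know about an estimator: it is a measurable function of
the observations made at the observation times. -/
structure IsEstimator (est : Finset ℕ → (ℕ → ℝ) → ℝ) : Prop where
  measurable : ∀ S, Measurable (est S)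
  congr : ∀ S z z', (∀ s ∈ S, z s = z' s) → est S z = est S z'

/-- The rewards offered by the arms before time `t`; later rewards are replaced by `0`. -/
def past {Ω : Type*} {N : ℕ} (X : Fin N → ℕ → Ω → ℝ) (t : ℕ) (ω : Ω) : ℕ → Fin N → ℝ :=
  fun s n => if s < t then X n s ω else 0

/-- The arm played by player `m` at time `t` as a function of the rewards `P s n` offered by the
arms, with no reference to the rewards received by the players: these enter the policy only through
exploration times, when no collisions occur. -/
noncomputable def armDecision {N M : ℕ} [NeZero N] (hMN : M ≤ N) (sch : Scheme)
    (o : Fin M → Fin N)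
    (ρ : ℕ → Equiv.Perm (Fin M)) (R : ℕ → Fin M → (Fin N → ℝ) → Equiv.Perm (Fin N))
    (D : ℕ → ℝ) (est : Finset ℕ → (ℕ → ℝ) → ℝ) (t : ℕ) (m : Fin M) (P : ℕ → Fin N → ℝ) : Fin N :=
  if t ∈ explSeq D t then explArm D o m t
  else exploitArm hMN (R t m (fun n => est (obsTimes D o m n t) (fun s => P s n))) (ρ t m) sch

theorem mem_obsTimes {N M : ℕ} [NeZero N] {D : ℕ → ℝ} {o : Fin M → Fin N} {m : Fin M} {n : Fin N}
    {s t : ℕ} (h : s ∈ obsTimes D o m n t) :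
    1 ≤ s ∧ s < t ∧ s ∈ explSeq D s ∧ explArm D o m s = n := by
  obtain ⟨h1, h2⟩ := Finset.mem_filter.1 h
  have h3 := Finset.mem_Ioc.1 (explSeq_subset _ _ h1)
  exact ⟨by omega, by omega, (mem_explSeq_iff D h3.2).1 h1, h2⟩

theorem explArm_injective {N M : ℕ} [NeZero N] {D : ℕ → ℝ} {o : Fin M → Fin N}
    (ho : Function.Injective o) (t : ℕ) : Function.Injective fun m => explArm D o m t :=
  injective_round ho _

/-! ### Independence of past and present rewards -/

section RewardProcess

variable {Ω : Type*} [MeasurableSpace Ω] {μ : Measure Ω} {N M : ℕ} {hMN : M ≤ N}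
  {X : Fin N → ℕ → Ω → ℝ} {K : ℝ} {A : ℕ → Fin M → Ω → Fin N} {Y : ℕ → Fin M → Ω → ℝ}

theorem measurable_past (hX : IsRewardProcess μ X) (t : ℕ) : Measurable (past X t) := by
  refine measurable_pi_lambda _ fun s => measurable_pi_lambda _ fun n => ?_
  unfold past
  split_ifs
  · exact hX.measurable n s
  · exact measurable_const

theorem indepFun_past (hX : IsRewardProcess μ X) (t : ℕ) (n : Fin N) :
    IndepFun (past X t) (X n t) μ := by
  have h := hX.indep.indepFun_finset (Finset.range t) {t} (by simp)
    (fun s => measurable_pi_lambda _ fun n => hX.measurable n s)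
  refine h.comp
    (φ := fun (P : Finset.range t → Fin N → ℝ) (s : ℕ) (n : Fin N) =>
      if hs : s < t then P ⟨s, Finset.mem_range.2 hs⟩ n else 0)
    (ψ := fun P : ({t} : Finset ℕ) → Fin N → ℝ => P ⟨t, Finset.mem_singleton_self t⟩ n) ?_ ?_
  · refine measurable_pi_lambda _ fun s => measurable_pi_lambda _ fun n => ?_
    split_ifs
    · exact (measurable_pi_apply n).comp (measurable_pi_apply _)
    · exact measurable_const
  · exact (measurable_pi_apply n).comp (measurable_pi_apply _)

theorem integrable_reward (hX : IsRewardProcess μ X) (n : Fin N) (t : ℕ) :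
    Integrable (X n t) μ :=
  (hX.identDistrib n t).integrable_iff.2 (hX.integrable n)

/-- The present reward of an arm keeps its mean on an event of the past. -/
theorem setIntegral_past (hX : IsRewardProcess μ X) (t : ℕ) (n : Fin N)
    {B : Set (ℕ → Fin N → ℝ)} (hB : MeasurableSet B) {φ : ℝ → ℝ} (hφ : Measurable φ) :
    ∫ ω in past X t ⁻¹' B, φ (X n t ω) ∂μ =
      μ.real (past X t ⁻¹' B) * ∫ ω, φ (X n 1 ω) ∂μ := by
  have hQ := measurable_past hX t
  have h1 : Measurable (B.indicator (fun _ => (1 : ℝ))) := measurable_const.indicator hB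
  have h := ((indepFun_past hX t n).comp h1 hφ).integral_fun_mul_eq_mul_integral
    (h1.comp hQ).aestronglyMeasurable (hφ.comp (hX.measurable n t)).aestronglyMeasurable
  have h2 : ∫ ω, φ (X n t ω) ∂μ = ∫ ω, φ (X n 1 ω) ∂μ :=
    ((hX.identDistrib n t).comp hφ).integral_eq
  have h3 : ∫ ω, B.indicator (fun _ => (1 : ℝ)) (past X t ω) ∂μ = μ.real (past X t ⁻¹' B) := by
    rw [← integral_indicator_one (hQ hB)]
    rfl
  rw [← integral_indicator (hQ hB), ← h2, ← h3]
  refine Eq.trans (integral_congr_ae (Eventually.of_forall fun ω => ?_)) h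
  by_cases hω : past X t ω ∈ B <;> simp [Set.indicator, hω]

/-! ### Rewards and regret under arbitrary local policies -/

/-- The players together receive at most the rewards of the arms played. -/
theorem IsPlay.sum_reward_le {π : Fin M → LocalPolicy N} (h : IsPlay X π K A Y) {t : ℕ}
    (ht : 1 ≤ t) (ω : Ω) :
    ∑ m, Y t m ω ≤ ∑ n, if ∃ m, A t m ω = n then X n t ω else 0 := by
  rw [← Finset.sum_fiberwise Finset.univ (fun m => A t m ω) (fun m => Y t m ω)]
  refine Finset.sum_le_sum fun n _ => ?_
  split_ifs with hn
  · obtain ⟨m, hm⟩ := hn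
    by_cases hc : ∃ m', m' ≠ m ∧ A t m' ω = n
    · obtain ⟨m', h1, h2⟩ := hc
      exact h.collision_sum_le t ht n ω ⟨m', m, h1, h2, hm⟩
    · push Not at hc
      have : (Finset.univ.filter fun m => A t m ω = n) = {m} := by
        ext m'
        simp only [Finset.mem_filter, Finset.mem_univ, true_and, Finset.mem_singleton]
        constructor
        · intro h'
          by_contra hne
          exact hc m' hne h'
        · rintro rfl
          exact hm
      rw [this, Finset.sum_singleton, h.alone t ht m ω fun m' hm' => hm ▸ hc m' hm', hm]
  · push Not at hn
    rw [Finset.filter_false_of_mem fun m _ => hn m, Finset.sum_empty]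

theorem stepLoss_nonneg {σ : Equiv.Perm (Fin N)}
    (hpos : ∀ k : Fin M, 0 < armMean μ X (σ (Fin.castLE hMN k))) (hK : 0 ≤ K) :
    0 ≤ stepLoss μ hMN X σ K := by
  have h1 : 0 ≤ ∑ k : Fin M, armMean μ X (σ (Fin.castLE hMN k)) :=
    Finset.sum_nonneg fun k _ => (hpos k).le
  have h2 : 0 ≤ ⨆ n, ∫ ω, |X n 1 ω| ∂μ :=
    Real.iSup_nonneg fun n => integral_nonneg fun ω => abs_nonneg _
  unfold stepLoss
  positivity

theorem systemRegret_eq_sum [IsProbabilityMeasure μ] (hX : IsRewardProcess μ X)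
    {σ : Equiv.Perm (Fin N)} (hK : 0 ≤ K) {π : Fin M → LocalPolicy N}
    (h : IsPlay X π K A Y) (T : ℕ) :
    systemRegret μ hMN X σ Y T = ∑ t ∈ Finset.Icc 1 T,
      (∑ k : Fin M, armMean μ X (σ (Fin.castLE hMN k)) - ∫ ω, ∑ m, Y t m ω ∂μ) := by
  rw [systemRegret, Finset.sum_sub_distrib, integral_finsetSum]
  · simp
  · intro t ht
    exact integrable_finsetSum _ fun m _ =>
      IsPlay.integrable hX hK h t (Finset.mem_Icc.1 ht).1 m

end RewardProcess

/-! ### Decisions depend on past rewards of the arms only -/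

section Play

variable {Ω : Type*} [MeasurableSpace Ω] {μ : Measure Ω} {N M : ℕ} [NeZero N] {hMN : M ≤ N}
  {X : Fin N → ℕ → Ω → ℝ} {K : ℝ} {sch : Scheme} {o : Fin M → Fin N}
  {ρ : ℕ → Equiv.Perm (Fin M)} {R : ℕ → Fin M → (Fin N → ℝ) → Equiv.Perm (Fin N)}
  {D : ℕ → ℝ} {est : Finset ℕ → (ℕ → ℝ) → ℝ} {A : ℕ → Fin M → Ω → Fin N} {Y : ℕ → Fin M → Ω → ℝ}

theorem IsPlay.arm_of_mem (h : IsPlay X (policy hMN sch o ρ R D est) K A Y) {t : ℕ} (ht : 1 ≤ t)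
    (hD : t ∈ explSeq D t) (m : Fin M) (ω : Ω) : A t m ω = explArm D o m t := by
  rw [h.decision t ht, policy, if_pos hD]

theorem IsPlay.reward_of_mem (h : IsPlay X (policy hMN sch o ρ R D est) K A Y)
    (ho : Function.Injective o) {t : ℕ} (ht : 1 ≤ t)
    (hD : t ∈ explSeq D t) (m : Fin M) (ω : Ω) : Y t m ω = X (explArm D o m t) t ω := by
  rw [h.alone t ht m ω, h.arm_of_mem ht hD]
  intro m' hm'
  rw [h.arm_of_mem ht hD, h.arm_of_mem ht hD]
  exact (explArm_injective ho t).ne hm'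

theorem IsPlay.arm_eq_armDecision (h : IsPlay X (policy hMN sch o ρ R D est) K A Y)
    (ho : Function.Injective o) (hest : IsEstimator est) {t : ℕ} (ht : 1 ≤ t) (m : Fin M) (ω : Ω) :
    A t m ω = armDecision hMN sch o ρ R D est t m (past X t ω) := by
  rw [h.decision t ht, policy, armDecision]
  split_ifs with hD
  · rfl
  · congr 2
    funext n
    refine hest.congr _ _ _ fun s hs => ?_
    obtain ⟨h1, h2, h3, h4⟩ := mem_obsTimes hs
    rw [rewardRecord, dif_pos (Finset.mem_Ico.2 ⟨h1, h2⟩), past, if_pos h2,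
      h.reward_of_mem ho h1 h3, h4]

theorem measurable_armDecision (hR : IsRankingRule R) (hest : IsEstimator est) (t : ℕ) (m : Fin M) :
    Measurable (armDecision hMN sch o ρ R D est t m) := by
  unfold armDecision
  split_ifs with hD
  · exact measurable_const
  · have hv : Measurable fun (P : ℕ → Fin N → ℝ) (n : Fin N) =>
        est (obsTimes D o m n t) (fun s => P s n) := by
      refine measurable_pi_lambda _ fun n => (hest.measurable _).comp ?_
      exact measurable_pi_lambda _ fun s => (measurable_pi_apply n).comp (measurable_pi_apply s)
    refine Measurable.comp (g := fun v => exploitArm hMN (R t m v) (ρ t m) sch) ?_ hv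
    refine measurable_to_countable' fun n => ?_
    have he : (fun v => exploitArm hMN (R t m v) (ρ t m) sch) ⁻¹' {n} =
        ⋃ r ∈ {r : Equiv.Perm (Fin N) | exploitArm hMN r (ρ t m) sch = n},
          ⋂ k, {v | R t m v k = r k} := by
      ext v
      simp only [Set.mem_preimage, Set.mem_singleton_iff, Set.mem_ofPred_eq, Set.mem_iUnion,
        Set.mem_iInter, exists_prop]
      constructor
      · intro h
        exact ⟨_, h, fun _ => rfl⟩
      · rintro ⟨r, h1, h2⟩
        rwa [show R t m v = r from Equiv.ext h2]
    rw [he]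
    refine MeasurableSet.biUnion (Set.to_countable _) fun r _ => MeasurableSet.iInter fun k => ?_
    exact hR.measurable t m k (measurableSet_singleton (r k))

/-! ### The expected reward of one step -/

/-- Rewards received in a collision are at most that of the arm, so no step yields more on average
than the top `M` arms. -/
theorem IsPlay.integral_reward_le [IsProbabilityMeasure μ] (hX : IsRewardProcess μ X)
    {σ : Equiv.Perm (Fin N)} (hσ : Antitone (armMean μ X ∘ σ))
    (hpos : ∀ k : Fin M, 0 < armMean μ X (σ (Fin.castLE hMN k))) (hK : 0 ≤ K)
    (ho : Function.Injective o) (hR : IsRankingRule R) (hest : IsEstimator est)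
    (h : IsPlay X (policy hMN sch o ρ R D est) K A Y) {t : ℕ} (ht : 1 ≤ t) :
    ∫ ω, ∑ m, Y t m ω ∂μ ≤ ∑ k : Fin M, armMean μ X (σ (Fin.castLE hMN k)) := by
  classical
  -- Whether an arm is played is an event of the past, so the arms played have, on average, the sum
  -- of their means as reward.
  set a := armDecision hMN sch o ρ R D est t
  have ha : ∀ m, Measurable (a m) := fun m => measurable_armDecision hR hest t m
  have hA : ∀ m ω, A t m ω = a m (past X t ω) := fun m ω => h.arm_eq_armDecision ho hest ht m ω
  set B : Fin N → Set (ℕ → Fin N → ℝ) := fun n => {P | ∃ m, a m P = n}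
  have hB : ∀ n, MeasurableSet (B n) := by
    intro n
    have : B n = ⋃ m, a m ⁻¹' {n} := by ext P; simp [B]
    rw [this]
    exact MeasurableSet.iUnion fun m => ha m (measurableSet_singleton n)
  have hQB : ∀ n, MeasurableSet (past X t ⁻¹' B n) := fun n => measurable_past hX t (hB n)
  have e1 : ∀ (g : Fin N → Ω → ℝ) n, (fun ω => if ∃ m, A t m ω = n then g n ω else 0) =
      (past X t ⁻¹' B n).indicator (g n) := by
    intro g n
    funext ω
    simp [Set.indicator, B, hA]
  have e : ∀ g : Fin N → Ω → ℝ, (∀ n, Integrable (g n) μ) →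
      ∫ ω, ∑ n, (if ∃ m, A t m ω = n then g n ω else 0) ∂μ =
        ∑ n, ∫ ω in past X t ⁻¹' B n, g n ω ∂μ := by
    intro g hg
    rw [integral_finsetSum]
    · refine Finset.sum_congr rfl fun n _ => ?_
      rw [e1, integral_indicator (hQB n)]
    · intro n _
      rw [e1]
      exact (hg n).indicator (hQB n)
  have hint : Integrable (fun ω => ∑ n, (if ∃ m, A t m ω = n then X n t ω else 0)) μ := by
    refine integrable_finsetSum _ fun n _ => ?_
    rw [e1 fun n => X n t]
    exact (integrable_reward hX n t).indicator (hQB n)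
  calc ∫ ω, ∑ m, Y t m ω ∂μ
      ≤ ∫ ω, ∑ n, (if ∃ m, A t m ω = n then X n t ω else 0) ∂μ :=
        integral_mono (integrable_finsetSum _ fun m _ => IsPlay.integrable hX hK h t ht m) hint
          fun ω => h.sum_reward_le ht ω
    _ = ∫ ω, ∑ n, (if ∃ m, A t m ω = n then armMean μ X n else 0) ∂μ := by
        rw [e _ fun n => integrable_reward hX n t,
          e (fun n _ => armMean μ X n) fun n => integrable_const _]
        refine Finset.sum_congr rfl fun n _ => ?_
        rw [setIntegral_const, smul_eq_mul]
        exact setIntegral_past hX t n (hB n) measurable_id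
    _ ≤ ∫ _, ∑ k : Fin M, armMean μ X (σ (Fin.castLE hMN k)) ∂μ := by
        refine integral_mono ?_ (integrable_const _) fun ω => ?_
        · refine integrable_finsetSum _ fun n _ => ?_
          rw [e1 fun n _ => armMean μ X n]
          exact (integrable_const _).indicator (hQB n)
        · dsimp only
          rw [← Finset.sum_filter]
          refine sum_le_sum_top hMN hσ hpos _ ?_
          have : (Finset.univ.filter fun n => ∃ m, A t m ω = n) =
              Finset.univ.image fun m => A t m ω := by ext n; simp
          rw [this]
          exact Finset.card_image_le.trans (by simp)
    _ = _ := by simp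

/-- The reward of an exploitation step falls short of the `M` largest means only if some estimate
is off by more than `δ`; this event belongs to the past, hence is independent of the present
rewards. -/
theorem IsPlay.le_integral_reward [IsProbabilityMeasure μ] (hX : IsRewardProcess μ X)
    {σ : Equiv.Perm (Fin N)} (hK : 0 ≤ K)
    (ho : Function.Injective o) (hR : IsRankingRule R) (hest : IsEstimator est)
    {δ g : ℝ} (hg : 2 * δ ≤ g) (hgap : IsBelowGap M (armMean μ X) σ g sch)
    (h : IsPlay X (policy hMN sch o ρ R D est) K A Y) {t : ℕ} (ht : 1 ≤ t)
    (hD : t ∉ explSeq D t) :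
    ∑ k : Fin M, armMean μ X (σ (Fin.castLE hMN k)) - ∫ ω, ∑ m, Y t m ω ∂μ ≤
      stepLoss μ hMN X σ K *
        μ.real {ω | ∃ m n, δ < |est (obsTimes D o m n t) (fun s => X n s ω) - armMean μ X n|} := by
  classical
  set Θ := ∑ k : Fin M, armMean μ X (σ (Fin.castLE hMN k)) with hΘ
  set a := armDecision hMN sch o ρ R D est t with ha_def
  have ha : ∀ m, Measurable (a m) := fun m => measurable_armDecision hR hest t m
  have hA : ∀ m ω, A t m ω = a m (past X t ω) := fun m ω => h.arm_eq_armDecision ho hest ht m ω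
  set B : Set (ℕ → Fin N → ℝ) :=
    {P | ∃ m n, δ < |est (obsTimes D o m n t) (fun s => P s n) - armMean μ X n|} with hBdef
  have hB : MeasurableSet B := by
    have hm : ∀ m n, Measurable fun P : ℕ → Fin N → ℝ =>
        |est (obsTimes D o m n t) (fun s => P s n) - armMean μ X n| := by
      intro m n
      have h1 : Measurable fun P : ℕ → Fin N → ℝ => est (obsTimes D o m n t) (fun s => P s n) :=
        (hest.measurable _).comp
          (measurable_pi_lambda _ fun s => (measurable_pi_apply n).comp (measurable_pi_apply s))
      exact continuous_abs.measurable.comp (h1.sub_const _)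
    have : B = ⋃ m, ⋃ n, {P | δ < |est (obsTimes D o m n t) (fun s => P s n) - armMean μ X n|} := by
      ext P; simp [B]
    rw [this]
    exact MeasurableSet.iUnion fun m => MeasurableSet.iUnion fun n =>
      measurableSet_lt measurable_const (hm m n)
  have hBeq : {ω | ∃ m n, δ < |est (obsTimes D o m n t) (fun s => X n s ω) - armMean μ X n|} =
      past X t ⁻¹' B := by
    ext ω
    have : ∀ m n, est (obsTimes D o m n t) (fun s => X n s ω) =
        est (obsTimes D o m n t) (fun s => past X t ω s n) := fun m n =>
      hest.congr _ _ _ fun s hs => by rw [past, if_pos (mem_obsTimes hs).2.1]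
    simp only [Set.mem_ofPred_eq, Set.mem_preimage, B, this]
  rw [hBeq]
  have hQ := measurable_past hX t
  set b : Fin M → Fin N := fun m => exploitArm hMN σ (ρ t m) sch with hb
  have hbinj : Function.Injective b := (exploitArm_injective hMN σ sch).comp (ρ t).injective
  have hbsum : ∀ f : Fin N → ℝ, ∑ m, f (b m) = ∑ k : Fin M, f (σ (Fin.castLE hMN k)) := by
    intro f
    rw [← sum_exploitArm hMN σ sch f]
    exact Equiv.sum_comp (ρ t) fun j => f (exploitArm hMN σ j sch)
  have hgood : ∀ P, P ∉ B → ∀ m, a m P = b m := by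
    intro P hP m
    have hP' : ∀ n, |est (obsTimes D o m n t) (fun s => P s n) - armMean μ X n| ≤ δ := by
      intro n
      by_contra hn
      exact hP ⟨m, n, not_le.1 hn⟩
    rw [ha_def, armDecision, if_neg hD]
    exact exploitArm_eq hMN hP' (hR.antitone t m _) hg hgap _
  -- Pointwise: exact rewards off the bad event, crude bounds on it.
  have hpt : ∀ ω, (∑ m, (past X t ⁻¹' Bᶜ).indicator (X (b m) t) ω) -
      ∑ m, ∑ n, (past X t ⁻¹' (B ∩ a m ⁻¹' {n})).indicator
        (fun ω => K + (1 + K) * |X n t ω|) ω ≤ ∑ m, Y t m ω := by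
    intro ω
    by_cases hω : past X t ω ∈ B
    · rw [← Finset.sum_sub_distrib]
      refine Finset.sum_le_sum fun m _ => ?_
      have e1 : ∑ n, (past X t ⁻¹' (B ∩ a m ⁻¹' {n})).indicator
          (fun ω => K + (1 + K) * |X n t ω|) ω = K + (1 + K) * |X (A t m ω) t ω| := by
        rw [Finset.sum_eq_single (A t m ω)]
        · simp [Set.indicator, hω, hA]
        · intro n _ hn
          rw [hA] at hn
          simp [Set.indicator, hn.symm]
        · simp
      rw [e1]
      simp only [Set.indicator, Set.mem_preimage, Set.mem_compl_iff, hω, not_true_eq_false,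
        if_false, zero_sub]
      have h0 := abs_nonneg (X (A t m ω) t ω)
      by_cases hc : ∃ m', m' ≠ m ∧ A t m' ω = A t m ω
      · refine le_trans ?_ (h.collision_ge t ht m ω hc)
        linarith
      · push Not at hc
        rw [h.alone t ht m ω hc]
        have := neg_abs_le (X (A t m ω) t ω)
        nlinarith
    · have e1 : ∀ m, Y t m ω = X (b m) t ω := by
        intro m
        have e2 : ∀ m, A t m ω = b m := fun m => by rw [hA, hgood _ hω]
        rw [h.alone t ht m ω, e2]
        intro m' hm'
        rw [e2, e2]
        exact hbinj.ne hm'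
      simp [Set.indicator, hω, e1]
  have hGm : MeasurableSet (past X t ⁻¹' Bᶜ) := hQ hB.compl
  have hBm : ∀ m n, MeasurableSet (B ∩ a m ⁻¹' {n}) := fun m n =>
    hB.inter (ha m (measurableSet_singleton n))
  have hI1 : ∀ m, Integrable ((past X t ⁻¹' Bᶜ).indicator (X (b m) t)) μ := fun m =>
    (integrable_reward hX _ t).indicator hGm
  have hI2 : ∀ m n, Integrable ((past X t ⁻¹' (B ∩ a m ⁻¹' {n})).indicator
      (fun ω => K + (1 + K) * |X n t ω|)) μ := fun m n =>
    ((integrable_const K).add ((integrable_reward hX n t).abs.const_mul (1 + K))).indicator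
      (hQ (hBm m n))
  set W := ⨆ n, ∫ ω, |X n 1 ω| ∂μ with hW
  have hWn : ∀ n, ∫ ω, |X n 1 ω| ∂μ ≤ W := fun n =>
    le_ciSup (f := fun n => ∫ ω, |X n 1 ω| ∂μ) (Set.finite_range _).bddAbove n
  have hi : ∀ n, ∫ ω, (K + (1 + K) * |X n 1 ω|) ∂μ ≤ K + (1 + K) * W := by
    intro n
    rw [integral_add (integrable_const _) ((hX.integrable n).abs.const_mul _), integral_const_mul]
    simp only [integral_const, probReal_univ, one_smul]
    have := hWn n
    gcongr
  have hsum : ∀ m, ∑ n, μ.real (past X t ⁻¹' (B ∩ a m ⁻¹' {n})) = μ.real (past X t ⁻¹' B) := by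
    intro m
    rw [← measureReal_biUnion_finset]
    · congr 1
      ext ω
      simp
    · intro n _ n' _ hn
      refine Set.disjoint_left.2 fun ω h1 h2 => hn ?_
      exact h1.2.symm.trans h2.2
    · exact fun n _ => hQ (hBm m n)
  have hlow : μ.real (past X t ⁻¹' Bᶜ) * Θ - M * (μ.real (past X t ⁻¹' B) * (K + (1 + K) * W)) ≤
      ∫ ω, ∑ m, Y t m ω ∂μ := by
    refine le_trans ?_ (integral_mono
      ((integrable_finsetSum _ fun m _ => hI1 m).sub
        (integrable_finsetSum _ fun m _ => integrable_finsetSum _ fun n _ => hI2 m n))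
      (integrable_finsetSum _ fun m _ => IsPlay.integrable hX hK h t ht m) hpt)
    rw [integral_sub' (integrable_finsetSum _ fun m _ => hI1 m)
        (integrable_finsetSum _ fun m _ => integrable_finsetSum _ fun n _ => hI2 m n),
      integral_finsetSum _ fun m _ => hI1 m,
      integral_finsetSum _ fun m _ => integrable_finsetSum _ fun n _ => hI2 m n]
    have e1 : ∑ m, ∫ ω, (past X t ⁻¹' Bᶜ).indicator (X (b m) t) ω ∂μ =
        μ.real (past X t ⁻¹' Bᶜ) * Θ := by
      rw [hΘ, ← hbsum (armMean μ X), Finset.mul_sum]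
      refine Finset.sum_congr rfl fun m _ => ?_
      rw [integral_indicator hGm]
      exact setIntegral_past hX t (b m) hB.compl measurable_id
    have e2 : ∀ m, ∫ ω, ∑ n, (past X t ⁻¹' (B ∩ a m ⁻¹' {n})).indicator
        (fun ω => K + (1 + K) * |X n t ω|) ω ∂μ ≤
          μ.real (past X t ⁻¹' B) * (K + (1 + K) * W) := by
      intro m
      rw [integral_finsetSum _ fun n _ => hI2 m n, ← hsum m, Finset.sum_mul]
      refine Finset.sum_le_sum fun n _ => ?_
      rw [integral_indicator (hQ (hBm m n)),
        setIntegral_past hX t n (hBm m n) (φ := fun x => K + (1 + K) * |x|) (by fun_prop)]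
      exact mul_le_mul_of_nonneg_left (hi n) measureReal_nonneg
    have e3 := Finset.sum_le_sum fun m (_ : m ∈ Finset.univ) => e2 m
    rw [Finset.sum_const, Finset.card_univ, Fintype.card_fin, nsmul_eq_mul] at e3
    rw [e1]
    linarith
  have hc : μ.real (past X t ⁻¹' Bᶜ) = 1 - μ.real (past X t ⁻¹' B) := by
    rw [Set.preimage_compl, probReal_compl_eq_one_sub (hQ hB)]
  rw [hc] at hlow
  rw [stepLoss]
  linarith

/-! ### Regret from error probabilities -/

theorem IsPlay.systemRegret_nonneg [IsProbabilityMeasure μ] (hX : IsRewardProcess μ X)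
    {σ : Equiv.Perm (Fin N)} (hσ : Antitone (armMean μ X ∘ σ))
    (hpos : ∀ k : Fin M, 0 < armMean μ X (σ (Fin.castLE hMN k))) (hK : 0 ≤ K)
    (ho : Function.Injective o) (hR : IsRankingRule R) (hest : IsEstimator est)
    (h : IsPlay X (policy hMN sch o ρ R D est) K A Y) (T : ℕ) :
    0 ≤ systemRegret μ hMN X σ Y T := by
  rw [systemRegret_eq_sum hX hK h]
  exact Finset.sum_nonneg fun t ht => sub_nonneg.2
    (h.integral_reward_le hX hσ hpos hK ho hR hest (Finset.mem_Icc.1 ht).1)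

/-- The regret is at most the loss of `q` exploration rounds plus that of the exploitation steps,
where `b t` bounds the probability of an estimate being off by more than `δ` at the exploitation
time `t`. -/
theorem IsPlay.systemRegret_le [IsProbabilityMeasure μ] (hX : IsRewardProcess μ X)
    {σ : Equiv.Perm (Fin N)} (hσ : Antitone (armMean μ X ∘ σ))
    (hpos : ∀ k : Fin M, 0 < armMean μ X (σ (Fin.castLE hMN k))) (hK : 0 ≤ K)
    (ho : Function.Injective o) (hR : IsRankingRule R) (hest : IsEstimator est)
    {δ g : ℝ} (hg : 2 * δ ≤ g) (hgap : IsBelowGap M (armMean μ X) σ g sch)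
    (h : IsPlay X (policy hMN sch o ρ R D est) K A Y) {T q : ℕ}
    (hq : (explSeq D T).card ≤ N * q) {b : ℕ → ℝ} (hb0 : ∀ t, 0 ≤ b t)
    (hb : ∀ t, 1 ≤ t → t ∉ explSeq D t → ∀ m n,
      μ.real {ω | δ < |est (obsTimes D o m n t) (fun s => X n s ω) - armMean μ X n|} ≤ b t) :
    systemRegret μ hMN X σ Y T ≤ q * explLoss μ hMN X σ +
      M * N * stepLoss μ hMN X σ K * ∑ t ∈ Finset.Icc 1 T, b t := by
  classical
  have hL : 0 ≤ stepLoss μ hMN X σ K := stepLoss_nonneg hpos hK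
  set l : ℕ → ℝ := fun t =>
    ∑ k : Fin M, armMean μ X (σ (Fin.castLE hMN k)) - ∫ ω, ∑ m, Y t m ω ∂μ with hl
  have hsub : explSeq D T ⊆ Finset.Icc 1 T :=
    (explSeq_subset D T).trans Finset.Ioc_subset_Icc_self
  rw [systemRegret_eq_sum hX hK h, ← Finset.sum_sdiff hsub, add_comm]
  refine add_le_add ?_ ?_
  · refine le_trans (le_of_eq (Finset.sum_congr rfl fun t ht => ?_))
      (sum_explLoss_le hMN hσ hpos ho D hq)
    have ht' := Finset.mem_Icc.1 (hsub ht)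
    congr 1
    simp_rw [h.reward_of_mem ho ht'.1 ((mem_explSeq_iff D ht'.2).1 ht)]
    rw [integral_finsetSum _ fun m _ => integrable_reward hX _ t]
    exact Finset.sum_congr rfl fun m _ => (hX.identDistrib _ t).integral_eq
  · rw [Finset.mul_sum]
    refine le_trans (Finset.sum_le_sum fun t ht => ?_)
      (Finset.sum_le_sum_of_subset_of_nonneg Finset.sdiff_subset fun t _ _ =>
        mul_nonneg (by positivity) (hb0 t))
    obtain ⟨ht1, ht2⟩ := Finset.mem_sdiff.1 ht
    obtain ⟨ht3, ht4⟩ := Finset.mem_Icc.1 ht1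
    rw [mem_explSeq_iff D ht4] at ht2
    refine (h.le_integral_reward hX hK ho hR hest hg hgap ht3 ht2).trans ?_
    rw [mul_comm (M * N : ℝ), mul_assoc]
    refine mul_le_mul_of_nonneg_left ?_ hL
    have hset : {ω | ∃ m n, δ < |est (obsTimes D o m n t) (fun s => X n s ω) - armMean μ X n|} =
        ⋃ m, ⋃ n, {ω | δ < |est (obsTimes D o m n t) (fun s => X n s ω) - armMean μ X n|} := by
      ext ω; simp
    rw [hset]
    calc _ ≤ ∑ m, ∑ n, μ.real
          {ω | δ < |est (obsTimes D o m n t) (fun s => X n s ω) - armMean μ X n|} :=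
          (measureReal_iUnion_fintype_le _).trans
            (Finset.sum_le_sum fun m _ => measureReal_iUnion_fintype_le _)
      _ ≤ ∑ _m : Fin M, ∑ _n : Fin N, b t :=
          Finset.sum_le_sum fun m _ => Finset.sum_le_sum fun n _ => hb t ht3 ht2 m n
      _ = _ := by simp; ring

end Play

/-! ### Independent identically distributed sequences -/

/-- A sequence of independent random variables with the same integrable law. -/
structure IsIIDSeq {Ω : Type*} [MeasurableSpace Ω] (μ : Measure Ω) (Z : ℕ → Ω → ℝ) : Prop where
  measurable : ∀ s, Measurable (Z s)
  indep : iIndepFun Z μ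
  identDistrib : ∀ s, IdentDistrib (Z s) (Z 1) μ μ
  integrable : Integrable (Z 1) μ

section Concentration

variable {Ω : Type*} [MeasurableSpace Ω] {μ : Measure Ω}

theorem IsRewardProcess.isIIDSeq {N : ℕ} {X : Fin N → ℕ → Ω → ℝ} (hX : IsRewardProcess μ X)
    (n : Fin N) : IsIIDSeq μ (X n) where
  measurable := hX.measurable n
  indep := hX.indep.comp (fun _ v => v n) fun _ => measurable_pi_apply n
  identDistrib := hX.identDistrib n
  integrable := hX.integrable n

theorem IsIIDSeq.comp {Z : ℕ → Ω → ℝ} (hZ : IsIIDSeq μ Z) {φ : ℝ → ℝ} (hφ : Measurable φ)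
    (hi : Integrable (fun ω => φ (Z 1 ω)) μ) : IsIIDSeq μ (fun s ω => φ (Z s ω)) where
  measurable s := hφ.comp (hZ.measurable s)
  indep := hZ.indep.comp (fun _ => φ) fun _ => hφ
  identDistrib s := (hZ.identDistrib s).comp hφ
  integrable := hi

theorem IsIIDSeq.neg {Z : ℕ → Ω → ℝ} (hZ : IsIIDSeq μ Z) : IsIIDSeq μ (fun s ω => -Z s ω) :=
  hZ.comp measurable_neg hZ.integrable.neg

/-- A two-sided tail bound for an estimator that commutes with negation follows from a one-sided
bound that applies to a sequence and its negative. -/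
theorem measureReal_abs_le [IsProbabilityMeasure μ] {Z : ℕ → Ω → ℝ} {e : (ℕ → ℝ) → ℝ}
    (he : ∀ z, e (fun s => -z s) = -e z) {δ b : ℝ}
    (h1 : μ.real {ω | δ < e (fun s => Z s ω) - ∫ ω, Z 1 ω ∂μ} ≤ b)
    (h2 : μ.real {ω | δ < e (fun s => -Z s ω) - ∫ ω, -Z 1 ω ∂μ} ≤ b) :
    μ.real {ω | δ < |e (fun s => Z s ω) - ∫ ω, Z 1 ω ∂μ|} ≤ 2 * b := by
  have hsub : {ω | δ < |e (fun s => Z s ω) - ∫ ω, Z 1 ω ∂μ|} ⊆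
      {ω | δ < e (fun s => Z s ω) - ∫ ω, Z 1 ω ∂μ} ∪
        {ω | δ < e (fun s => -Z s ω) - ∫ ω, -Z 1 ω ∂μ} := by
    intro ω hω
    rcases lt_abs.1 (show δ < |_| from hω) with h | h
    · exact Or.inl h
    · refine Or.inr ?_
      change δ < _
      rw [he, integral_neg]
      linarith
  calc _ ≤ _ := measureReal_mono hsub
    _ ≤ _ := measureReal_union_le _ _
    _ ≤ _ := by linarith

/-- Chernoff's bound for a sum of independent variables. -/
theorem measureReal_le_sum_le [IsProbabilityMeasure μ] {Y : ℕ → Ω → ℝ}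
    (hm : ∀ s, Measurable (Y s)) (hi : iIndepFun Y μ) (S : Finset ℕ) {l b : ℝ} (hl : 0 ≤ l)
    {c : ℕ → ℝ} (hint : ∀ s ∈ S, Integrable (fun ω => Real.exp (l * Y s ω)) μ)
    (hmgf : ∀ s ∈ S, mgf (Y s) μ l ≤ Real.exp (c s)) :
    μ.real {ω | b ≤ ∑ s ∈ S, Y s ω} ≤ Real.exp (-l * b + ∑ s ∈ S, c s) := by
  have h := measure_ge_le_exp_mul_mgf (μ := μ) (X := ∑ s ∈ S, Y s) b hl
    (hi.integrable_exp_mul_sum hm hint)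
  rw [hi.mgf_sum hm, Finset.sum_fn] at h
  refine h.trans ?_
  rw [Real.exp_add, Real.exp_sum]
  exact mul_le_mul_of_nonneg_left (Finset.prod_le_prod (fun _ _ => mgf_nonneg) hmgf)
    (Real.exp_pos _).le

/-! ### Light tails -/

theorem Ioo_subset_interior_integrableExpSet {Z : Ω → ℝ} {u₀ : ℝ} (h : IsLightTailedOn μ Z u₀) :
    Set.Ioo (-u₀) u₀ ⊆ interior (integrableExpSet Z μ) :=
  interior_maximal (fun _ hu => h _ (abs_le.2 ⟨hu.1.le, hu.2.le⟩)) isOpen_Ioo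

theorem IsLightTailedOn.sub_const {Z : Ω → ℝ} {u₀ : ℝ} (h : IsLightTailedOn μ Z u₀) (c : ℝ) :
    IsLightTailedOn μ (fun ω => Z ω - c) u₀ := by
  intro u hu
  refine ((h u hu).mul_const (Real.exp (-(u * c)))).congr (Eventually.of_forall fun ω => ?_)
  dsimp only
  rw [← Real.exp_add]
  ring_nf

/-- A variable whose centred moment-generating function has second derivative at most `ζ` is locally
sub-Gaussian with variance proxy `ζ`. -/
theorem IsMgfCurvatureBound.mgf_le [IsProbabilityMeasure μ] {Z : Ω → ℝ} {u₀ ζ : ℝ}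
    (hZ : Integrable Z μ) (hlt : IsLightTailedOn μ Z u₀) (h : IsMgfCurvatureBound μ Z u₀ ζ)
    {u : ℝ} (hu : |u| < u₀) :
    mgf (fun ω => Z ω - ∫ ω', Z ω' ∂μ) μ u ≤ Real.exp (ζ * u ^ 2 / 2) := by
  set W : Ω → ℝ := fun ω => Z ω - ∫ ω', Z ω' ∂μ with hW
  rcases eq_or_ne u 0 with rfl | hu0
  · simp
  have hsub := Ioo_subset_interior_integrableExpSet (hlt.sub_const (∫ ω', Z ω' ∂μ))
  have hu' := abs_lt.1 hu
  have h0u : 0 < u₀ := (abs_nonneg u).trans_lt hu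
  have hIcc : Set.uIcc 0 u ⊆ Set.Ioo (-u₀) u₀ :=
    Set.OrdConnected.uIcc_subset Set.ordConnected_Ioo ⟨by linarith, h0u⟩ hu'
  have han : AnalyticOnNhd ℝ (mgf W μ) (Set.uIcc 0 u) :=
    analyticOnNhd_mgf.mono (hIcc.trans hsub)
  obtain ⟨x, hx, he⟩ := taylor_mean_remainder_lagrange_iteratedDeriv (n := 1) hu0.symm
    (han.contDiffOn (uniqueDiffOn_uIcc hu0.symm))
  have h0 : (0 : ℝ) ∈ interior (integrableExpSet W μ) := hsub ⟨by linarith, h0u⟩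
  have hd : derivWithin (mgf W μ) (Set.uIcc 0 u) 0 = 0 := by
    rw [(differentiableAt_mgf h0).derivWithin (uniqueDiffOn_uIcc hu0.symm _ Set.left_mem_uIcc),
      deriv_mgf_zero h0, hW, integral_sub hZ (integrable_const _)]
    simp
  rw [taylorWithinEval_succ, taylor_within_zero_eval, iteratedDerivWithin_one, hd,
    mgf_zero] at he
  have hx' : |x| < u₀ := abs_lt.2 (hIcc (Set.uIoo_subset_uIcc_self hx))
  have hc := h x hx'
  have h2 : iteratedDeriv 2 (mgf W μ) x * u ^ 2 ≤ ζ * u ^ 2 :=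
    mul_le_mul_of_nonneg_right hc (sq_nonneg u)
  norm_num at he
  have := Real.add_one_le_exp (ζ * u ^ 2 / 2)
  linarith

/-- If the rewards are light-tailed, a curvature bound holds on a smaller interval. -/
theorem IsLightTailedOn.exists_curvatureBound {Z : Ω → ℝ} {u₀ : ℝ}
    (h0 : 0 < u₀) (h : IsLightTailedOn μ Z u₀) :
    ∃ ζ, 0 < ζ ∧ IsMgfCurvatureBound μ Z (u₀ / 2) ζ := by
  have hsub := Ioo_subset_interior_integrableExpSet (h.sub_const (∫ ω', Z ω' ∂μ))
  have hc : ContinuousOn (iteratedDeriv 2 (mgf (fun ω => Z ω - ∫ ω', Z ω' ∂μ) μ))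
      (Set.Icc (-(u₀ / 2)) (u₀ / 2)) := fun x hx =>
    (analyticAt_iteratedDeriv_mgf (hsub ⟨by linarith [hx.1], by linarith [hx.2]⟩)
      2).continuousAt.continuousWithinAt
  obtain ⟨ζ, hζ⟩ := isCompact_Icc.bddAbove_image hc
  refine ⟨max ζ 1, by positivity, fun u hu => ?_⟩
  have hu' := abs_lt.1 hu
  exact (hζ ⟨u, ⟨hu'.1.le, hu'.2.le⟩, rfl⟩).trans (le_max_left _ _)

theorem IsMgfCurvatureBound.mono {Z : Ω → ℝ} {u₀ ζ ζ' : ℝ} (h : IsMgfCurvatureBound μ Z u₀ ζ)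
    (hζ : ζ ≤ ζ') : IsMgfCurvatureBound μ Z u₀ ζ' := fun u hu => (h u hu).trans hζ

/-- Nonemptiness matters: the sample mean of no observations is the junk value `0 / 0 = 0`. -/
theorem lt_sampleMean_sub_iff {S : Finset ℕ} (hS : S.Nonempty) {z : ℕ → ℝ} {θ δ : ℝ} :
    δ < sampleMean S z - θ ↔ S.card * (θ + δ) < ∑ s ∈ S, z s := by
  have hc : (0 : ℝ) < S.card := by exact_mod_cast hS.card_pos
  rw [sampleMean, lt_sub_iff_add_lt, lt_div_iff₀ hc]
  rw [show δ + θ = θ + δ by ring, mul_comm]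

theorem sampleMean_neg (S : Finset ℕ) (z : ℕ → ℝ) :
    sampleMean S (fun s => -z s) = -sampleMean S z := by
  simp [sampleMean, Finset.sum_neg_distrib, neg_div]

/-- Chernoff's bound for the upper tail of the sample mean of variables that are sub-Gaussian for
parameters in `(0, u₀)`. -/
theorem sampleMean_tail_of_mgf_le [IsProbabilityMeasure μ] {Z : ℕ → Ω → ℝ} (hZ : IsIIDSeq μ Z)
    {u₀ ζ δ θ : ℝ} (hζ : 0 < ζ) (hδ : 0 < δ) (hδu : δ ≤ ζ * u₀)
    (hint : ∀ u, 0 < u → u < u₀ → Integrable (fun ω => Real.exp (u * (Z 1 ω - θ))) μ)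
    (hmgf : ∀ u, 0 < u → u < u₀ → mgf (fun ω => Z 1 ω - θ) μ u ≤ Real.exp (ζ * u ^ 2 / 2))
    (S : Finset ℕ) :
    μ.real {ω | δ < sampleMean S (fun s => Z s ω) - θ} ≤
      Real.exp (-(δ ^ 2 / (2 * ζ) * S.card)) := by
  rcases S.eq_empty_or_nonempty with rfl | hS
  · simp
  have hlt : 0 < δ / ζ := by positivity
  have hle : δ / ζ ≤ u₀ := by rw [div_le_iff₀ hζ]; linarith
  -- Chernoff's bound with `u < δ / ζ`; the optimal `u = δ / ζ` is reached in the limit, since it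
  -- may be the endpoint `u₀`.
  have key : ∀ u ∈ Set.Ioo 0 (δ / ζ), μ.real {ω | δ < sampleMean S (fun s => Z s ω) - θ} ≤
      Real.exp (S.card * (ζ * u ^ 2 / 2 - u * δ)) := by
    intro u hu
    have hu1 : u < u₀ := hu.2.trans_le hle
    have hid : ∀ s, IdentDistrib (fun ω => Z s ω - θ) (fun ω => Z 1 ω - θ) μ μ := fun s =>
      (hZ.identDistrib s).comp (u := fun x => x - θ) (by fun_prop)
    have h := measureReal_le_sum_le (μ := μ) (Y := fun s ω => Z s ω - θ)
      (fun s => (hZ.measurable s).sub_const θ)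
      (hZ.indep.comp (fun _ x => x - θ) fun _ => by fun_prop) S (l := u) (b := S.card * δ) hu.1.le
      (c := fun _ => ζ * u ^ 2 / 2)
      (fun s _ => ((hid s).comp (u := fun x => Real.exp (u * x)) (by fun_prop)).integrable_iff.2
        (hint u hu.1 hu1))
      (fun s _ => by
        rw [show mgf (fun ω => Z s ω - θ) μ u = mgf (fun ω => Z 1 ω - θ) μ u from
          ((hid s).comp (u := fun x => Real.exp (u * x)) (by fun_prop)).integral_eq]
        exact hmgf u hu.1 hu1)
    refine (measureReal_mono ?_).trans (h.trans (le_of_eq ?_))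
    · intro ω hω
      have := (lt_sampleMean_sub_iff hS).1 (show δ < _ from hω)
      change _ ≤ ∑ s ∈ S, (Z s ω - θ)
      rw [Finset.sum_sub_distrib, Finset.sum_const, nsmul_eq_mul]
      linarith
    · rw [Finset.sum_const, nsmul_eq_mul]
      ring_nf
  have hlim : Tendsto (fun u : ℝ => Real.exp (S.card * (ζ * u ^ 2 / 2 - u * δ)))
      (nhdsWithin (δ / ζ) (Set.Iio (δ / ζ)))
      (nhds (Real.exp (S.card * (ζ * (δ / ζ) ^ 2 / 2 - δ / ζ * δ)))) := by
    refine Tendsto.mono_left (Continuous.tendsto ?_ _) nhdsWithin_le_nhds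
    fun_prop
  refine (ge_of_tendsto hlim ?_).trans (le_of_eq ?_)
  · filter_upwards [Ioo_mem_nhdsLT hlt] with u hu using key u hu
  · congr 1
    field_simp
    ring

/-- Chernoff's bound for the sample mean of light-tailed variables. -/
theorem sampleMean_lightTail [IsProbabilityMeasure μ] {Z : ℕ → Ω → ℝ} (hZ : IsIIDSeq μ Z)
    {u₀ ζ δ : ℝ} (hlt : IsLightTailedOn μ (Z 1) u₀) (hcurv : IsMgfCurvatureBound μ (Z 1) u₀ ζ)
    (hζ : 0 < ζ) (hδ : 0 < δ) (hδu : δ ≤ ζ * u₀) (S : Finset ℕ) :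
    μ.real {ω | δ < |sampleMean S (fun s => Z s ω) - ∫ ω, Z 1 ω ∂μ|} ≤
      2 * Real.exp (-(δ ^ 2 / (2 * ζ) * S.card)) := by
  set θ := ∫ ω, Z 1 ω ∂μ with hθ
  have h1 : ∀ u, |u| < u₀ → Integrable (fun ω => Real.exp (u * (Z 1 ω - θ))) μ := fun u hu =>
    hlt.sub_const θ u hu.le
  have h2 : ∀ u, |u| < u₀ → mgf (fun ω => Z 1 ω - θ) μ u ≤ Real.exp (ζ * u ^ 2 / 2) := fun u hu =>
    hcurv.mgf_le hZ.integrable hlt hu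
  have h3 : ∀ u, (fun ω => Real.exp (u * (-Z 1 ω - -θ))) =
      fun ω => Real.exp (-u * (Z 1 ω - θ)) := fun u => by
    funext ω; congr 1; ring
  refine measureReal_abs_le (sampleMean_neg S) ?_ ?_
  · exact sampleMean_tail_of_mgf_le hZ hζ hδ hδu
      (fun u h h' => h1 u (by rwa [abs_of_pos h])) (fun u h h' => h2 u (by rwa [abs_of_pos h])) S
  · rw [integral_neg]
    refine sampleMean_tail_of_mgf_le hZ.neg hζ hδ hδu (fun u h h' => ?_) (fun u h h' => ?_) S
    · rw [h3]
      exact h1 (-u) (by rwa [abs_neg, abs_of_pos h])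
    · rw [mgf, h3, ← neg_sq u]
      exact h2 (-u) (by rwa [abs_neg, abs_of_pos h])

end Concentration

/-! ### Truncated variables -/

/-- Truncation of a real number at level `B`: values larger than `B` in modulus are replaced by
`0`. -/
noncomputable def trunc (B z : ℝ) : ℝ := if |z| ≤ B then z else 0

theorem measurable_trunc (B : ℝ) : Measurable (trunc B) :=
  Measurable.ite (measurableSet_le (by fun_prop) measurable_const) measurable_id measurable_const

theorem trunc_neg (B z : ℝ) : trunc B (-z) = -trunc B z := by
  unfold trunc
  rw [abs_neg]
  split_ifs <;> simp

theorem abs_trunc_le {B : ℝ} (hB : 0 ≤ B) (z : ℝ) : |trunc B z| ≤ B := by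
  unfold trunc
  split_ifs with h
  · exact h
  · simpa using hB

/-- The bias of truncation is controlled by a higher moment. -/
theorem trunc_sub_le {B p : ℝ} (hB : 0 < B) (hp : 1 ≤ p) (z : ℝ) :
    trunc B z - z ≤ |z| ^ p * B ^ (1 - p) := by
  unfold trunc
  split_ifs with h
  · rw [sub_self]; positivity
  · have hz : 0 < |z| := hB.trans (not_le.1 h)
    have h1 : |z| ^ (1 - p) ≤ B ^ (1 - p) :=
      Real.rpow_le_rpow_of_nonpos hB (not_le.1 h).le (by linarith)
    calc 0 - z ≤ |z| := by linarith [neg_abs_le z]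
      _ = |z| ^ p * |z| ^ (1 - p) := by rw [← Real.rpow_add hz]; simp
      _ ≤ _ := by gcongr

theorem sq_trunc_le {B q : ℝ} (hB : 0 < B) (hq : q ≤ 2) (z : ℝ) :
    trunc B z ^ 2 ≤ |z| ^ q * B ^ (2 - q) := by
  unfold trunc
  split_ifs with h
  · rcases eq_or_ne z 0 with rfl | hz
    · simp only [ne_eq, OfNat.ofNat_ne_zero, not_false_eq_true, zero_pow]
      positivity
    · have hz' : 0 < |z| := abs_pos.2 hz
      calc z ^ 2 = |z| ^ q * |z| ^ (2 - q) := by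
            rw [← Real.rpow_add hz', ← sq_abs]; norm_num
        _ ≤ _ := by gcongr
  · simp only [ne_eq, OfNat.ofNat_ne_zero, not_false_eq_true, zero_pow]
    positivity

theorem exp_le_one_add_add_sq_mul_exp (x : ℝ) : Real.exp x ≤ 1 + x + Real.exp |x| * x ^ 2 := by
  have h := Complex.norm_exp_sub_sum_le_norm_mul_exp (x : ℂ) 2
  have e : Complex.exp (x : ℂ) - ∑ m ∈ Finset.range 2, (x : ℂ) ^ m / (m.factorial : ℂ) =
      ((Real.exp x - (1 + x) : ℝ) : ℂ) := by
    simp [Finset.sum_range_succ]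
  -- The complex remainder estimate is specialized to real arguments.
  rw [e, Complex.norm_real, Complex.norm_real, Real.norm_eq_abs, Real.norm_eq_abs, sq_abs] at h
  linarith [le_abs_self (Real.exp x - (1 + x))]

section Truncation

variable {Ω : Type*} [MeasurableSpace Ω] {μ : Measure Ω}

/-- A bounded variable obeys a Bernstein-type bound when a quadratic upper bound of `exp` holds on
its range. -/
theorem mgf_le_of_exp_le [IsProbabilityMeasure μ] {Y : Ω → ℝ} (hm : Measurable Y) {B l κ : ℝ}
    (hB : ∀ ω, |Y ω| ≤ B) (h : ∀ ω, Real.exp (l * Y ω) ≤ 1 + l * Y ω + κ * (l * Y ω) ^ 2) :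
    mgf Y μ l ≤ Real.exp (l * ∫ ω, Y ω ∂μ + κ * l ^ 2 * ∫ ω, Y ω ^ 2 ∂μ) := by
  have h1 : Integrable Y μ :=
    Integrable.of_bound hm.aestronglyMeasurable B (Eventually.of_forall hB)
  have h2 : Integrable (fun ω => Y ω ^ 2) μ := by
    refine Integrable.of_bound (hm.pow_const 2).aestronglyMeasurable (B ^ 2)
      (Eventually.of_forall fun ω => ?_)
    rw [norm_pow]
    exact pow_le_pow_left₀ (norm_nonneg _) (hB ω) 2
  have h4 : Integrable (fun ω => 1 + l * Y ω) μ := (integrable_const _).add (h1.const_mul l)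
  have h3 : Integrable (fun ω => 1 + l * Y ω + κ * l ^ 2 * Y ω ^ 2) μ := h4.add (h2.const_mul _)
  calc mgf Y μ l ≤ ∫ ω, (1 + l * Y ω + κ * l ^ 2 * Y ω ^ 2) ∂μ :=
        integral_mono_of_nonneg (Eventually.of_forall fun ω => (Real.exp_pos _).le) h3
          (Eventually.of_forall fun ω => (h ω).trans (le_of_eq (by ring)))
    _ = 1 + l * ∫ ω, Y ω ∂μ + κ * l ^ 2 * ∫ ω, Y ω ^ 2 ∂μ := by
        rw [integral_add h4 (h2.const_mul _),
          integral_add (integrable_const _) (h1.const_mul l), integral_const_mul,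
          integral_const_mul]
        simp
    _ ≤ _ := by
        rw [add_assoc, add_comm]
        exact Real.add_one_le_exp _

theorem integrable_rpow_of_le [IsProbabilityMeasure μ] {Z : Ω → ℝ} (hZ : Measurable Z) {p q : ℝ}
    (hq : 0 ≤ q) (hqp : q ≤ p) (h : Integrable (fun ω => |Z ω| ^ p) μ) :
    Integrable (fun ω => |Z ω| ^ q) μ := by
  refine ((integrable_const (1 : ℝ)).add h).mono'
    (Measurable.aestronglyMeasurable (by fun_prop)) (Eventually.of_forall fun ω => ?_)
  rw [Real.norm_eq_abs, abs_of_nonneg (by positivity)]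
  change |Z ω| ^ q ≤ 1 + |Z ω| ^ p
  have hp0 : 0 ≤ |Z ω| ^ p := by positivity
  rcases le_total |Z ω| 1 with h1 | h1
  · linarith [Real.rpow_le_one (abs_nonneg (Z ω)) h1 hq]
  · linarith [Real.rpow_le_rpow_of_exponent_le h1 hqp]

/-- Upper tail of a sum of truncated variables, by Chernoff's bound with parameter `r / B`: the
`p`-th moment controls the bias of the truncation and the `q`-th moment its variance. -/
theorem trunc_tail_le [IsProbabilityMeasure μ] {Z : ℕ → Ω → ℝ} (hZ : IsIIDSeq μ Z)
    {p q u u' B r κ : ℝ} (hp : 1 ≤ p) (hq : q ≤ 2)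
    (hpi : Integrable (fun ω => |Z 1 ω| ^ p) μ) (hpu : ∫ ω, |Z 1 ω| ^ p ∂μ ≤ u)
    (hqi : Integrable (fun ω => |Z 1 ω| ^ q) μ) (hqu : ∫ ω, |Z 1 ω| ^ q ∂μ ≤ u')
    (hB : 0 < B) (hr : 0 ≤ r) (hκ : 0 ≤ κ)
    (hexp : ∀ x : ℝ, |x| ≤ r → Real.exp x ≤ 1 + x + κ * x ^ 2)
    (S : Finset ℕ) {β : ℕ → ℝ} (hβ0 : ∀ s ∈ S, 0 < β s) (hβB : ∀ s ∈ S, β s ≤ B) (b : ℝ) :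
    μ.real {ω | b ≤ ∑ s ∈ S, trunc (β s) (Z s ω)} ≤
      Real.exp (-(r / B) * b + (r / B * (S.card * ∫ ω, Z 1 ω ∂μ + u * ∑ s ∈ S, β s ^ (1 - p)) +
        κ * (r / B) ^ 2 * (S.card * (u' * B ^ (2 - q))))) := by
  set l := r / B with hl
  have hl0 : 0 ≤ l := by positivity
  have hm : ∀ s, Measurable fun ω => trunc (β s) (Z s ω) := fun s =>
    (measurable_trunc _).comp (hZ.measurable s)
  have hbd : ∀ s ∈ S, ∀ ω, |trunc (β s) (Z s ω)| ≤ B := fun s hs ω =>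
    (abs_trunc_le (hβ0 s hs).le _).trans (hβB s hs)
  have hbl : ∀ s ∈ S, ∀ ω, |l * trunc (β s) (Z s ω)| ≤ r := by
    intro s hs ω
    rw [abs_mul, abs_of_nonneg hl0, hl, div_mul_eq_mul_div, div_le_iff₀ hB]
    exact mul_le_mul_of_nonneg_left (hbd s hs ω) hr
  have hmean : ∀ s ∈ S, ∫ ω, trunc (β s) (Z s ω) ∂μ ≤ ∫ ω, Z 1 ω ∂μ + u * β s ^ (1 - p) := by
    intro s hs
    have e : ∫ ω, trunc (β s) (Z s ω) ∂μ = ∫ ω, trunc (β s) (Z 1 ω) ∂μ :=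
      ((hZ.identDistrib s).comp (measurable_trunc _)).integral_eq
    have hti : Integrable (fun ω => trunc (β s) (Z 1 ω)) μ :=
      Integrable.of_bound ((measurable_trunc _).comp (hZ.measurable 1)).aestronglyMeasurable (β s)
        (Eventually.of_forall fun ω => abs_trunc_le (hβ0 s hs).le _)
    have h1 : ∫ ω, (trunc (β s) (Z 1 ω) - Z 1 ω) ∂μ ≤ ∫ ω, |Z 1 ω| ^ p * β s ^ (1 - p) ∂μ :=
      integral_mono (hti.sub hZ.integrable) (hpi.mul_const _) fun ω =>
        trunc_sub_le (hβ0 s hs) hp _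
    rw [integral_sub hti hZ.integrable, integral_mul_const] at h1
    have h2 : (∫ ω, |Z 1 ω| ^ p ∂μ) * β s ^ (1 - p) ≤ u * β s ^ (1 - p) :=
      mul_le_mul_of_nonneg_right hpu (Real.rpow_nonneg (hβ0 s hs).le _)
    rw [e]
    linarith
  have hvar : ∀ s ∈ S, ∫ ω, trunc (β s) (Z s ω) ^ 2 ∂μ ≤ u' * B ^ (2 - q) := by
    intro s hs
    have e : ∫ ω, trunc (β s) (Z s ω) ^ 2 ∂μ = ∫ ω, trunc (β s) (Z 1 ω) ^ 2 ∂μ :=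
      ((hZ.identDistrib s).comp ((measurable_trunc (β s)).pow_const 2)).integral_eq
    rw [e]
    calc _ ≤ ∫ ω, |Z 1 ω| ^ q * B ^ (2 - q) ∂μ := by
          refine integral_mono_of_nonneg (Eventually.of_forall fun ω => sq_nonneg _)
            (hqi.mul_const _) (Eventually.of_forall fun ω => ?_)
          refine (sq_trunc_le (hβ0 s hs) hq _).trans ?_
          have := hβB s hs
          have := hβ0 s hs
          dsimp only
          gcongr
      _ ≤ _ := by
          rw [integral_mul_const]
          gcongr
  refine (measureReal_le_sum_le hm
    (hZ.indep.comp (fun s => trunc (β s)) fun s => measurable_trunc _) S hl0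
    (fun s hs => ?_) (fun s hs => mgf_le_of_exp_le (hm s) (hbd s hs)
      fun ω => hexp _ (hbl s hs ω))).trans ?_
  · refine Integrable.of_bound (Measurable.aestronglyMeasurable ?_) (Real.exp r)
      (Eventually.of_forall fun ω => ?_)
    · exact Real.measurable_exp.comp ((hm s).const_mul l)
    · rw [Real.norm_eq_abs, Real.abs_exp]
      exact Real.exp_le_exp.2 ((le_abs_self _).trans (hbl s hs ω))
  · refine Real.exp_le_exp.2 (add_le_add le_rfl ?_)
    rw [Finset.sum_add_distrib, ← Finset.mul_sum, ← Finset.mul_sum]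
    have h1 := Finset.sum_le_sum hmean
    have h2 := Finset.sum_le_sum hvar
    rw [Finset.sum_add_distrib, ← Finset.mul_sum, Finset.sum_const, nsmul_eq_mul] at h1
    rw [Finset.sum_const, nsmul_eq_mul] at h2
    gcongr

/-! ### Truncated sample means -/

/-- Summing over the ranks of the elements of a set. -/
theorem sum_rank {α : Type*} [AddCommMonoid α] (S : Finset ℕ) (g : ℕ → α) :
    ∑ s ∈ S, g (S.filter (fun r => r ≤ s)).card = ∑ k ∈ Finset.Icc 1 S.card, g k := by
  induction S using Finset.induction_on_max with
  | empty => simp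
  | insert a S ha ih =>
    have hn : a ∉ S := fun h => lt_irrefl _ (ha a h)
    rw [Finset.sum_insert hn, Finset.card_insert_of_notMem hn,
      Finset.sum_Icc_succ_top (by omega), ← ih, add_comm]
    congr 1
    · refine Finset.sum_congr rfl fun s hs => ?_
      rw [Finset.filter_insert, if_neg (not_le.2 (ha s hs))]
    · rw [Finset.filter_true_of_mem, Finset.card_insert_of_notMem hn]
      intro r hr
      rcases Finset.mem_insert.1 hr with rfl | hr
      · exact le_rfl
      · exact (ha r hr).le

theorem truncMean_eq (p u a δ : ℝ) (S : Finset ℕ) (z : ℕ → ℝ) :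
    truncMean p u a δ S z = (∑ s ∈ S, trunc ((u * ((S.filter (fun r => r ≤ s)).card : ℝ)
      / (a * δ ^ (p / (p - 1)) * S.card)) ^ (1 / p)) (z s)) / S.card := by
  simp only [truncMean, truncEps, trunc, Real.log_inv, Real.log_exp, neg_neg]

theorem truncMean_neg (p u a δ : ℝ) (S : Finset ℕ) (z : ℕ → ℝ) :
    truncMean p u a δ S (fun s => -z s) = -truncMean p u a δ S z := by
  simp only [truncMean_eq, trunc_neg, Finset.sum_neg_distrib, neg_div]

/-- One-sided tail of the truncated sample mean. With `L = a δ^(p/(p-1))` and the largest truncation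
level `B = (u/L)^(1/p)`, the choice of `a` means `δ = 4 L B`; Chernoff's bound with parameter `1/B`
has exponent `τ L (-4 + p + 1)`, where `p ≤ 2` comes from the bias and `1` from the variance. -/
theorem truncMean_tail [IsProbabilityMeasure μ] {Z : ℕ → Ω → ℝ} (hZ : IsIIDSeq μ Z)
    {p u a δ : ℝ} (hp : 1 < p) (hp2 : p ≤ 2) (hu : 0 < u)
    (hpi : Integrable (fun ω => |Z 1 ω| ^ p) μ) (hpu : ∫ ω, |Z 1 ω| ^ p ∂μ ≤ u)
    (ha : a = (4 : ℝ) ^ (p / (1 - p)) * u ^ (1 / (1 - p))) (hδ : 0 < δ) (S : Finset ℕ) :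
    μ.real {ω | δ < truncMean p u a δ S (fun s => Z s ω) - ∫ ω, Z 1 ω ∂μ} ≤
      Real.exp (-(a * δ ^ (p / (p - 1)) * S.card)) := by
  rcases S.eq_empty_or_nonempty with rfl | hS
  · simp
  have ha0 : 0 < a := by rw [ha]; positivity
  have hp0 : 0 < p := by linarith
  have hp1 : p - 1 ≠ 0 := by linarith
  have hp1' : 1 - p ≠ 0 := by linarith
  set L := a * δ ^ (p / (p - 1)) with hL
  have hL0 : 0 < L := by positivity
  set τ : ℝ := (S.card : ℝ) with hτ
  have hτ0 : 0 < τ := by rw [hτ]; exact_mod_cast hS.card_pos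
  set B := (u / L) ^ (1 / p) with hBdef
  have hB0 : 0 < B := by positivity
  set θ := ∫ ω, Z 1 ω ∂μ with hθ
  have hBp : u * B ^ (-p) = L := by
    rw [hBdef, ← Real.rpow_mul (by positivity), show 1 / p * -p = -1 by field_simp,
      Real.rpow_neg_one]
    field_simp
  have hδL : 4 * L * B = δ := by
    have e1 : L ^ (1 - 1 / p) = a ^ (1 - 1 / p) * δ := by
      rw [hL, Real.mul_rpow ha0.le (by positivity), ← Real.rpow_mul hδ.le,
        show p / (p - 1) * (1 - 1 / p) = 1 by field_simp, Real.rpow_one]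
    have e2 : a ^ (1 - 1 / p) = 4⁻¹ * u ^ (-(1 / p)) := by
      rw [ha, Real.mul_rpow (by positivity) (by positivity), ← Real.rpow_mul (by norm_num),
        ← Real.rpow_mul hu.le, show p / (1 - p) * (1 - 1 / p) = -1 by field_simp; ring,
        show 1 / (1 - p) * (1 - 1 / p) = -(1 / p) by field_simp; ring, Real.rpow_neg_one]
    have e3 : L * B = u ^ (1 / p) * L ^ (1 - 1 / p) := by
      rw [hBdef, Real.div_rpow hu.le hL0.le, Real.rpow_sub hL0, Real.rpow_one]
      ring
    rw [mul_assoc, e3, e1, e2, Real.rpow_neg hu.le]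
    have : u ^ (1 / p) ≠ 0 := by positivity
    field_simp
  let k : ℕ → ℕ := fun s => (S.filter (fun r => r ≤ s)).card
  let β : ℕ → ℝ := fun s => (u * (k s : ℝ) / (L * τ)) ^ (1 / p)
  have hk1 : ∀ s ∈ S, (0 : ℝ) < k s := by
    intro s hs
    exact Nat.cast_pos.2 (Finset.card_pos.2 ⟨s, Finset.mem_filter.2 ⟨hs, le_rfl⟩⟩)
  have hkτ : ∀ s, (k s : ℝ) ≤ τ := by
    intro s
    exact Nat.cast_le.2 (Finset.card_filter_le _ _)
  have hβ0 : ∀ s ∈ S, 0 < β s := by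
    intro s hs
    have := hk1 s hs
    positivity
  have hβB : ∀ s ∈ S, β s ≤ B := by
    intro s hs
    have := hk1 s hs
    refine Real.rpow_le_rpow (by positivity) ?_ (by positivity)
    rw [div_le_div_iff₀ (by positivity) hL0]
    nlinarith [mul_le_mul_of_nonneg_left (hkτ s) (mul_pos hu hL0).le]
  -- The bias: the truncation levels grow, and `∑ k^(1/p-1) ≤ p τ^(1/p)`.
  have hbias : u * ∑ s ∈ S, β s ^ (1 - p) ≤ L * B * (p * τ) := by
    have e1 : ∀ s ∈ S, β s ^ (1 - p) = B ^ (1 - p) * τ ^ (1 - 1 / p) * (k s : ℝ) ^ (1 / p - 1) := by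
      intro s hs
      have h0 := hk1 s hs
      have e2 : β s = B * ((k s : ℝ) ^ (1 / p) * τ ^ (-(1 / p))) := by
        change (u * (k s : ℝ) / (L * τ)) ^ (1 / p) = _
        rw [hBdef, show u * (k s : ℝ) / (L * τ) = u / L * ((k s : ℝ) / τ) by field_simp,
          Real.mul_rpow (by positivity) (by positivity), Real.div_rpow h0.le hτ0.le,
          Real.rpow_neg hτ0.le]
        ring
      rw [e2, Real.mul_rpow hB0.le (by positivity), Real.mul_rpow (by positivity) (by positivity),
        ← Real.rpow_mul h0.le, ← Real.rpow_mul hτ0.le,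
        show 1 / p * (1 - p) = 1 / p - 1 by field_simp,
        show -(1 / p) * (1 - p) = 1 - 1 / p by field_simp; ring]
      ring
    rw [Finset.sum_congr rfl e1, ← Finset.mul_sum,
      sum_rank S (fun k => (k : ℝ) ^ (1 / p - 1))]
    have h1 := sum_rpow_sub_one_le (α := 1 / p) (by positivity)
      (by rw [div_le_one hp0]; exact hp.le) S.card
    have e3 : u * B ^ (1 - p) = L * B := by
      rw [show 1 - p = -p + 1 by ring, Real.rpow_add hB0, Real.rpow_one, ← mul_assoc, hBp]
    have e4 : τ ^ (1 - 1 / p) * (τ ^ (1 / p) / (1 / p)) = p * τ := by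
      rw [Real.rpow_sub hτ0, Real.rpow_one]
      have : τ ^ (1 / p) ≠ 0 := by positivity
      field_simp
    calc _ = u * B ^ (1 - p) * (τ ^ (1 - 1 / p) *
          ∑ k ∈ Finset.Icc 1 S.card, (k : ℝ) ^ (1 / p - 1)) := by ring
      _ ≤ u * B ^ (1 - p) * (τ ^ (1 - 1 / p) * (τ ^ (1 / p) / (1 / p))) := by gcongr
      _ = _ := by rw [e3, e4]
  have h := trunc_tail_le hZ (q := p) hp.le hp2 hpi hpu hpi hpu hB0 zero_le_one zero_le_one
    (fun x hx => by
      rw [one_mul]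
      linarith [le_abs_self (Real.exp x - 1 - x), Real.abs_exp_sub_one_sub_id_le hx]) S hβ0 hβB
    (τ * (θ + δ))
  refine (measureReal_mono ?_).trans (h.trans (Real.exp_le_exp.2 ?_))
  · intro ω hω
    have h1 : δ < truncMean p u a δ S (fun s => Z s ω) - θ := hω
    rw [truncMean_eq, lt_sub_iff_add_lt, lt_div_iff₀ hτ0] at h1
    change τ * (θ + δ) ≤ ∑ s ∈ S, trunc (β s) (Z s ω)
    linarith
  · have e5 : u * B ^ (2 - p) = L * B ^ 2 := by
      rw [show 2 - p = -p + 2 by ring, Real.rpow_add hB0, ← mul_assoc, hBp]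
      norm_num
    rw [e5]
    have h2 : 1 / B * (u * ∑ s ∈ S, β s ^ (1 - p)) ≤ 1 / B * (L * B * (p * τ)) := by gcongr
    have e6 : 1 / B * (L * B * (p * τ)) = L * (p * τ) := by field_simp
    have e7 : -(1 / B) * (τ * (θ + δ)) + 1 / B * (τ * θ) = -(4 * L * τ) := by
      rw [← hδL]; field_simp; ring
    have e8 : 1 * (1 / B) ^ 2 * (τ * (L * B ^ 2)) = τ * L := by field_simp
    have h3 : L * (p * τ) ≤ L * (2 * τ) := by gcongr
    rw [e8, mul_add]
    linarith

theorem truncMean_concentration [IsProbabilityMeasure μ] {Z : ℕ → Ω → ℝ} (hZ : IsIIDSeq μ Z)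
    {p u a δ : ℝ} (hp : 1 < p) (hp2 : p ≤ 2) (hu : 0 < u)
    (hpi : Integrable (fun ω => |Z 1 ω| ^ p) μ) (hpu : ∫ ω, |Z 1 ω| ^ p ∂μ ≤ u)
    (ha : a = (4 : ℝ) ^ (p / (1 - p)) * u ^ (1 / (1 - p))) (hδ : 0 < δ) (S : Finset ℕ) :
    μ.real {ω | δ < |truncMean p u a δ S (fun s => Z s ω) - ∫ ω, Z 1 ω ∂μ|} ≤
      2 * Real.exp (-(a * δ ^ (p / (p - 1)) * S.card)) :=
  measureReal_abs_le (truncMean_neg p u a δ S) (truncMean_tail hZ hp hp2 hu hpi hpu ha hδ S)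
    (truncMean_tail hZ.neg hp hp2 hu (by simpa using hpi) (by simpa using hpu) ha hδ S)

end Truncation

/-! ### Sample means of heavy-tailed variables -/

section HeavyTail

variable {Ω : Type*} [MeasurableSpace Ω] {μ : Measure Ω}

/-- One-sided tail of the sample mean of `τ` variables with a finite `p`-th moment. The variables
are truncated at `η τ`; Chernoff's bound is applied with parameter `κ log τ / (η τ)`, where `κ` is
so small that the variance term stays bounded, and `η` such that the main term is `τ^(1-p)`. -/
theorem sampleMean_heavyTail_upper [IsProbabilityMeasure μ] {Z : ℕ → Ω → ℝ} (hZ : IsIIDSeq μ Z)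
    {p δ : ℝ} (hp : 1 < p) (hpi : Integrable (fun ω => |Z 1 ω| ^ p) μ) (hδ : 0 < δ) :
    ∃ C : ℝ, ∀ S : Finset ℕ, S.Nonempty →
      μ.real {ω | δ < sampleMean S (fun s => Z s ω) - ∫ ω, Z 1 ω ∂μ} ≤
        C * (S.card : ℝ) ^ (1 - p) := by
  set q := min p 2 with hq
  have hq1 : 1 < q := lt_min hp (by norm_num)
  have hqp : q ≤ p := min_le_left _ _
  have hq2 : q ≤ 2 := min_le_right _ _
  have hp1 : 0 < p - 1 := by linarith
  set κ := (q - 1) / 2 with hκ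
  have hκ0 : 0 < κ := by rw [hκ]; linarith
  set η := κ * δ / (p - 1) with hη
  have hη0 : 0 < η := by positivity
  have hqi := integrable_rpow_of_le (hZ.measurable 1) (by linarith) hqp hpi
  set u := ∫ ω, |Z 1 ω| ^ p ∂μ with hu
  have hu0 : 0 ≤ u := integral_nonneg fun ω => by positivity
  set u' := ∫ ω, |Z 1 ω| ^ q ∂μ with hu'
  have hu'0 : 0 ≤ u' := integral_nonneg fun ω => by positivity
  set θ := ∫ ω, Z 1 ω ∂μ with hθ
  refine ⟨u * η ^ (-p) +
    Real.exp (κ / η * u * η ^ (1 - p) / (p - 1) + 2 * u' * η ^ (-q)), fun S hS => ?_⟩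
  set τ : ℝ := (S.card : ℝ) with hτ
  have hτ1 : 1 ≤ τ := by rw [hτ]; exact_mod_cast hS.card_pos
  have hτ0 : 0 < τ := by linarith
  set B := η * τ with hB
  have hB0 : 0 < B := by positivity
  set s := κ * Real.log τ with hs
  have hs0 : 0 ≤ s := mul_nonneg hκ0.le (Real.log_nonneg hτ1)
  -- The probability that a variable is changed by the truncation.
  have hlarge : ∀ t, μ.real {ω | B < |Z t ω|} ≤ u * B ^ (-p) := by
    intro t
    have hid : IdentDistrib (fun ω => |Z t ω| ^ p) (fun ω => |Z 1 ω| ^ p) μ μ :=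
      (hZ.identDistrib t).comp (u := fun x => |x| ^ p) (by fun_prop)
    have h := mul_meas_ge_le_integral_of_nonneg (μ := μ) (f := fun ω => |Z t ω| ^ p)
      (Eventually.of_forall fun ω => by dsimp only [Pi.zero_apply]; positivity)
      (hid.integrable_iff.2 hpi) (B ^ p)
    rw [hid.integral_eq] at h
    rw [Real.rpow_neg hB0.le, ← div_eq_mul_inv, le_div_iff₀ (by positivity), mul_comm]
    refine le_trans (mul_le_mul_of_nonneg_left (measureReal_mono fun ω hω => ?_)
      (by positivity)) h
    exact Real.rpow_le_rpow hB0.le (le_of_lt hω) (by linarith)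
  have htail := trunc_tail_le hZ (κ := Real.exp s) hp.le hq2 hpi le_rfl hqi le_rfl hB0 hs0
    (Real.exp_pos s).le
    (fun x hx => (exp_le_one_add_add_sq_mul_exp x).trans (by gcongr)) S (β := fun _ => B)
    (fun _ _ => hB0) (fun _ _ => le_rfl) (τ * (θ + δ))
  rw [← hτ, ← hθ, ← hu, ← hu'] at htail
  have hsub : {ω | δ < sampleMean S (fun s => Z s ω) - θ} ⊆
      (⋃ t ∈ S, {ω | B < |Z t ω|}) ∪ {ω | τ * (θ + δ) ≤ ∑ t ∈ S, trunc B (Z t ω)} := by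
    intro ω hω
    by_cases hc : ∃ t ∈ S, B < |Z t ω|
    · exact Or.inl (by simpa using hc)
    · push Not at hc
      refine Or.inr ?_
      change τ * (θ + δ) ≤ ∑ t ∈ S, trunc B (Z t ω)
      rw [Finset.sum_congr rfl fun t ht => show trunc B (Z t ω) = Z t ω from if_pos (hc t ht)]
      exact ((lt_sampleMean_sub_iff hS).1 hω).le
  have h1 : μ.real (⋃ t ∈ S, {ω | B < |Z t ω|}) ≤ u * η ^ (-p) * τ ^ (1 - p) := by
    calc _ ≤ ∑ t ∈ S, μ.real {ω | B < |Z t ω|} := measureReal_biUnion_finset_le _ _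
      _ ≤ ∑ _t ∈ S, u * B ^ (-p) := Finset.sum_le_sum fun t _ => hlarge t
      _ = _ := by
        rw [Finset.sum_const, nsmul_eq_mul, ← hτ, hB, Real.mul_rpow hη0.le hτ0.le,
          show 1 - p = 1 + -p by ring, Real.rpow_add hτ0, Real.rpow_one]
        ring
  have h2 : -(s / B) * (τ * (θ + δ)) + (s / B * (τ * θ + u * ∑ _t ∈ S, B ^ (1 - p)) +
      Real.exp s * (s / B) ^ 2 * (τ * (u' * B ^ (2 - q)))) ≤
      -(p - 1) * Real.log τ +
        (κ / η * u * η ^ (1 - p) / (p - 1) + 2 * u' * η ^ (-q)) := by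
    have e1 : s / B * (τ * δ) = (p - 1) * Real.log τ := by
      rw [hs, hB, hη]; field_simp
    have e2 : s / B * (u * ∑ _t ∈ S, B ^ (1 - p)) ≤ κ / η * u * η ^ (1 - p) / (p - 1) := by
      have h3 : Real.log τ * τ ^ (1 - p) ≤ 1 / (p - 1) := by
        have h4 := Real.log_le_rpow_div hτ0.le hp1
        calc Real.log τ * τ ^ (1 - p) ≤ τ ^ (p - 1) / (p - 1) * τ ^ (1 - p) := by gcongr
          _ = τ ^ (p - 1) * τ ^ (1 - p) / (p - 1) := by ring
          _ = 1 / (p - 1) := by rw [← Real.rpow_add hτ0]; simp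
      calc _ = κ / η * u * η ^ (1 - p) * (Real.log τ * τ ^ (1 - p)) := by
            rw [Finset.sum_const, nsmul_eq_mul, ← hτ, hs, hB, Real.mul_rpow hη0.le hτ0.le]
            field_simp
        _ ≤ κ / η * u * η ^ (1 - p) * (1 / (p - 1)) := by gcongr
        _ = _ := by ring
    have e3 : Real.exp s * (s / B) ^ 2 * (τ * (u' * B ^ (2 - q))) ≤ 2 * u' * η ^ (-q) := by
      have h3 : Real.exp s * s ^ 2 ≤ 2 * τ ^ (q - 1) := by
        have h4 := Real.quadratic_le_exp_of_nonneg hs0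
        have h5 : τ ^ (q - 1) = Real.exp s * Real.exp s := by
          rw [← Real.exp_add, Real.rpow_def_of_pos hτ0, hs, hκ]
          ring_nf
        rw [h5]
        nlinarith [Real.exp_pos s]
      have h6 : B ^ (2 - q) = B ^ 2 * (η ^ (-q) * τ ^ (-q)) := by
        rw [← Real.mul_rpow hη0.le hτ0.le, ← hB, sub_eq_add_neg, Real.rpow_add hB0]
        norm_num
      have h7 : τ ^ (q - 1) * (τ * τ ^ (-q)) = 1 := by
        rw [show τ * τ ^ (-q) = τ ^ (1 - q) by
          rw [show 1 - q = 1 + -q by ring, Real.rpow_add hτ0, Real.rpow_one],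
          ← Real.rpow_add hτ0]
        simp
      calc _ = Real.exp s * s ^ 2 * (u' * η ^ (-q) * (τ * τ ^ (-q))) := by
            rw [h6]; field_simp
        _ ≤ 2 * τ ^ (q - 1) * (u' * η ^ (-q) * (τ * τ ^ (-q))) := by gcongr
        _ = 2 * u' * η ^ (-q) * (τ ^ (q - 1) * (τ * τ ^ (-q))) := by ring
        _ = _ := by rw [h7, mul_one]
    rw [mul_add (s / B) (τ * θ)]
    linarith [mul_add (s / B) (τ * θ) (τ * δ), mul_add τ θ δ,
      show -(s / B) * (τ * (θ + δ)) = -(s / B * (τ * θ)) - s / B * (τ * δ) by ring]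
  have h3 : Real.exp (-(p - 1) * Real.log τ) = τ ^ (1 - p) := by
    rw [Real.rpow_def_of_pos hτ0]; ring_nf
  calc _ ≤ _ := measureReal_mono hsub
    _ ≤ _ := measureReal_union_le _ _
    _ ≤ u * η ^ (-p) * τ ^ (1 - p) + _ := add_le_add h1 (htail.trans (Real.exp_le_exp.2 h2))
    _ = _ := by rw [Real.exp_add, h3]; ring

theorem sampleMean_heavyTail [IsProbabilityMeasure μ] {Z : ℕ → Ω → ℝ} (hZ : IsIIDSeq μ Z)
    {p δ : ℝ} (hp : 1 < p) (hpi : Integrable (fun ω => |Z 1 ω| ^ p) μ) (hδ : 0 < δ) :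
    ∃ C : ℝ, ∀ S : Finset ℕ,
      μ.real {ω | δ < |sampleMean S (fun s => Z s ω) - ∫ ω, Z 1 ω ∂μ|} ≤
        C * ((S.card : ℝ) + 1) ^ (1 - p) := by
  obtain ⟨C₁, h1⟩ := sampleMean_heavyTail_upper hZ hp hpi hδ
  obtain ⟨C₂, h2⟩ := sampleMean_heavyTail_upper hZ.neg hp (by simpa using hpi) hδ
  set C := max 1 (max C₁ C₂) with hC
  have hC1 : 1 ≤ C := le_max_left _ _
  have hC0 : 0 ≤ C := by linarith
  refine ⟨2 * (C * 2 ^ (p - 1)), fun S => ?_⟩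
  rcases S.eq_empty_or_nonempty with rfl | hS
  · have : (1 : ℝ) ≤ 2 ^ (p - 1) := Real.one_le_rpow (by norm_num) (by linarith)
    refine measureReal_le_one.trans ?_
    simp only [Finset.card_empty, Nat.cast_zero, zero_add, Real.one_rpow, mul_one]
    nlinarith
  · have hτ : (1 : ℝ) ≤ S.card := by exact_mod_cast hS.card_pos
    have h3 : (S.card : ℝ) ^ (1 - p) ≤ 2 ^ (p - 1) * ((S.card : ℝ) + 1) ^ (1 - p) := by
      have h4 : (S.card : ℝ) ^ (1 - p) ≤ (((S.card : ℝ) + 1) / 2) ^ (1 - p) :=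
        Real.rpow_le_rpow_of_nonpos (by positivity) (by linarith) (by linarith)
      rw [Real.div_rpow (by positivity) (by norm_num), div_eq_mul_inv,
        ← Real.rpow_neg (by norm_num), neg_sub, mul_comm] at h4
      exact h4
    have h4 : ∀ C', C' ≤ C → C' * (S.card : ℝ) ^ (1 - p) ≤
        C * (2 ^ (p - 1) * ((S.card : ℝ) + 1) ^ (1 - p)) := by
      intro C' hC'
      calc _ ≤ C * (S.card : ℝ) ^ (1 - p) := by gcongr
        _ ≤ _ := by gcongr
    refine (measureReal_abs_le (sampleMean_neg S)
      ((h1 S hS).trans (h4 _ ((le_max_left _ _).trans (le_max_right _ _))))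
      ((h2 S hS).trans (h4 _ ((le_max_right _ _).trans (le_max_right _ _))))).trans
      (le_of_eq (by ring))

end HeavyTail

/-! ### Regret of the policies -/

theorem isEstimator_sampleMean : IsEstimator sampleMean where
  measurable S := by unfold sampleMean; fun_prop
  congr S z z' h := by
    unfold sampleMean
    rw [Finset.sum_congr rfl h]

theorem isEstimator_truncMean (p u a δ : ℝ) : IsEstimator (truncMean p u a δ) where
  measurable S := by
    have : truncMean p u a δ S = _ := funext (truncMean_eq p u a δ S)
    rw [this]
    exact (Finset.measurable_sum _ fun s _ =>
      (measurable_trunc _).comp (measurable_pi_apply s)).div_const _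
  congr S z z' h := by
    rw [truncMean_eq, truncMean_eq]
    congr 1
    exact Finset.sum_congr rfl fun s hs => by rw [h s hs]

/-- At an exploitation time the threshold has been reached, which bounds the number of observations
of each arm by each player from below. -/
theorem le_card_obsTimes_of_notMem {N M : ℕ} [NeZero N] {D : ℕ → ℝ} (o : Fin M → Fin N)
    (m : Fin M) (n : Fin N) {t q : ℕ} (ht : 1 < t) (hD : t ∉ explSeq D t) (hq : (N * q : ℝ) ≤ D t) :
    q ≤ (obsTimes D o m n t).card := by
  obtain ⟨t, rfl⟩ : ∃ k, t = k + 1 := ⟨t - 1, by omega⟩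
  refine le_card_obsTimes o m n ?_
  have := hq.trans ((explSeq_succ_of_notMem D hD).2 (by omega))
  exact_mod_cast this

theorem sampleMean_exp_tail {Ω : Type*} [MeasurableSpace Ω] {μ : Measure Ω}
    [IsProbabilityMeasure μ] {N : ℕ} {X : Fin N → ℕ → Ω → ℝ} (hX : IsRewardProcess μ X)
    {u₀ ζ δ : ℝ} (hζ : 0 < ζ)
    (hlt : ∀ n, IsLightTailedOn μ (X n 1) u₀) (hcurv : ∀ n, IsMgfCurvatureBound μ (X n 1) u₀ ζ)
    (hδ : 0 < δ) (hδu : δ ≤ ζ * u₀) {r : ℝ} (hr : r ≤ δ ^ 2 / (2 * ζ)) (n : Fin N) (S : Finset ℕ) :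
    μ.real {ω | δ < |sampleMean S (fun s => X n s ω) - armMean μ X n|} ≤
      2 * Real.exp (-(r * (S.card : ℝ))) := by
  refine (sampleMean_lightTail (hX.isIIDSeq n) (hlt n) (hcurv n) hζ hδ hδu S).trans ?_
  gcongr

/-- The last inequality, an equality for `p ≤ 2`, makes `∑ t^(α(1-p))` at most of order `T^α`: the
exploitation loss is then balanced with the exploration loss. -/
theorem heavyExponent_bounds {p : ℝ} (hp : 1 < p) :
    0 < heavyExponent p ∧ heavyExponent p ≤ 1 ∧ 1 ≤ heavyExponent p * p := by
  unfold heavyExponent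
  split_ifs with h
  · refine ⟨by positivity, ?_, ?_⟩
    · rw [div_le_one (by linarith)]; exact hp.le
    · rw [div_mul_cancel₀ _ (by linarith)]
  · have h0 : 0 < 1 + p / 2 := by linarith
    refine ⟨by positivity, ?_, ?_⟩
    · rw [div_le_one h0]; linarith
    · rw [div_mul_eq_mul_div, le_div_iff₀ h0]; linarith

section Regret

variable {Ω : Type*} [MeasurableSpace Ω] {μ : Measure Ω} [IsProbabilityMeasure μ] {N M : ℕ}
  [NeZero N] {hMN : M ≤ N} {X : Fin N → ℕ → Ω → ℝ} {K : ℝ} {sch : Scheme} {o : Fin M → Fin N}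
  {ρ : ℕ → Equiv.Perm (Fin M)} {R : ℕ → Fin M → (Fin N → ℝ) → Equiv.Perm (Fin N)}
  {est : Finset ℕ → (ℕ → ℝ) → ℝ} {A : ℕ → Fin M → Ω → Fin N} {Y : ℕ → Fin M → Ω → ℝ}
  {σ : Equiv.Perm (Fin N)}

/-- Regret for thresholds `N ⌈g(t) log t⌉` and an estimator with exponential concentration. -/
theorem IsPlay.systemRegret_le_of_exp_tail (hX : IsRewardProcess μ X)
    (hσ : Antitone (armMean μ X ∘ σ))
    (hpos : ∀ k : Fin M, 0 < armMean μ X (σ (Fin.castLE hMN k))) (hK : 0 ≤ K)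
    (ho : Function.Injective o) (hR : IsRankingRule R) (hest : IsEstimator est)
    {δ c : ℝ} (hc : 2 * δ ≤ c) (hgap : IsBelowGap M (armMean μ X) σ c sch)
    {r : ℝ} (hr : 0 ≤ r)
    (htail : ∀ n S, μ.real {ω | δ < |est S (fun s => X n s ω) - armMean μ X n|} ≤
      2 * Real.exp (-(r * (S.card : ℝ))))
    {g : ℕ → ℝ} (hg : Monotone g) (hg0 : ∀ t, 0 ≤ g t)
    (h : IsPlay X (policy hMN sch o ρ R (fun t => N * ⌈g t * Real.log t⌉₊) est) K A Y) (T : ℕ) :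
    systemRegret μ hMN X σ Y T ≤ ⌈g T * Real.log T⌉₊ * explLoss μ hMN X σ +
      M * N * stepLoss μ hMN X σ K *
        ∑ t ∈ Finset.Icc 1 T, 2 * (t : ℝ) ^ (-(r * g t)) := by
  refine h.systemRegret_le hX hσ hpos hK ho hR hest hc hgap ?_ (fun t => by positivity) ?_
  · refine card_explSeq_le fun t h1 h2 => ?_
    push_cast
    have ht : (0 : ℝ) < t := by exact_mod_cast (by omega : 0 < t)
    have : 0 ≤ Real.log t := Real.log_nonneg (by exact_mod_cast h1.le)
    have := hg0 T
    have := hg h2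
    gcongr
  · intro t ht hD m n
    refine (htail n _).trans ?_
    rcases ht.eq_or_lt with rfl | ht'
    -- At time `1` nothing has been observed; the claimed probability bound is then `2`.
    · simp only [Nat.cast_one, Real.one_rpow]
      gcongr
      rw [Real.exp_le_one_iff]
      exact neg_nonpos.2 (by positivity)
    · have h1 := le_card_obsTimes_of_notMem o m n ht' hD le_rfl
      have h2 : g t * Real.log t ≤
          ((obsTimes (fun t : ℕ => (N : ℝ) * (⌈g t * Real.log t⌉₊ : ℝ)) o m n t).card : ℝ) :=
        (Nat.le_ceil _).trans (by exact_mod_cast h1)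
      rw [Real.rpow_def_of_pos (by exact_mod_cast (by omega : 0 < t))]
      gcongr
      nlinarith

/-- The logarithmic regret bound when the threshold constant `w` fits the concentration rate. -/
theorem IsPlay.systemRegret_le_log (hX : IsRewardProcess μ X)
    (hσ : Antitone (armMean μ X ∘ σ))
    (hpos : ∀ k : Fin M, 0 < armMean μ X (σ (Fin.castLE hMN k))) (hK : 0 ≤ K)
    (ho : Function.Injective o) (hR : IsRankingRule R) (hest : IsEstimator est)
    {δ c : ℝ} (hc : 2 * δ ≤ c) (hgap : IsBelowGap M (armMean μ X) σ c sch)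
    {r w : ℝ} (hr : 0 < r) (hw : 1 / r < w)
    (htail : ∀ n S, μ.real {ω | δ < |est S (fun s => X n s ω) - armMean μ X n|} ≤
      2 * Real.exp (-(r * (S.card : ℝ))))
    (h : IsPlay X (policy hMN sch o ρ R (fun t => N * ⌈w * Real.log t⌉₊) est) K A Y) (T : ℕ) :
    systemRegret μ hMN X σ Y T ≤ ⌈w * Real.log T⌉₊ * explLoss μ hMN X σ +
      2 * M * N * stepLoss μ hMN X σ K * (1 + 1 / (r * w - 1)) := by
  have hw0 : 0 < w := lt_trans (by positivity) hw
  have hrw : 1 < r * w := by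
    rw [div_lt_iff₀ hr] at hw
    linarith
  have hL : 0 ≤ stepLoss μ hMN X σ K := stepLoss_nonneg hpos hK
  refine (h.systemRegret_le_of_exp_tail hX hσ hpos hK ho hR hest hc hgap hr.le htail
    (g := fun _ => w) monotone_const (fun _ => hw0.le) T).trans (add_le_add le_rfl ?_)
  rw [← Finset.mul_sum]
  calc _ ≤ M * N * stepLoss μ hMN X σ K * (2 * (1 + 1 / (r * w - 1))) := by
        gcongr
        exact sum_rpow_neg_le hrw T
    _ = _ := by ring

/-- Regret of order `f(T) log T` when the tail parameters are unknown: the exponent `r f(t)` of the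
error probability eventually exceeds `2`, so the exploitation loss stays bounded. -/
theorem exists_regret_le_of_lightTail (hX : IsRewardProcess μ X)
    (hσ : Antitone (armMean μ X ∘ σ))
    (hpos : ∀ k : Fin M, 0 < armMean μ X (σ (Fin.castLE hMN k))) (hK : 0 ≤ K)
    (ho : Function.Injective o) (hR : IsRankingRule R) {f : ℕ → ℝ} {u₀ : ℝ} (hu₀ : 0 < u₀)
    (hlt : ∀ n, IsLightTailedOn μ (X n 1) u₀) (hgap : IsBelowGap M (armMean μ X) σ 0 sch)
    (hf0 : ∀ t, 0 < f t) (hf : Monotone f) (hfT : Tendsto f atTop atTop) :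
    ∃ C : ℝ, ∀ A Y, IsPlay X
      (policy hMN sch o ρ R (fun t => N * ⌈f t * Real.log t⌉₊) sampleMean) K A Y →
      ∀ T : ℕ, 2 ≤ T → |systemRegret μ hMN X σ Y T| ≤ C * (f T * Real.log T) := by
  obtain ⟨c, hc0, hgap'⟩ := hgap.exists_pos
  choose z hz0 hz using fun n => (hlt n).exists_curvatureBound hu₀
  obtain ⟨ζ, hζ⟩ := (Set.finite_range z).bddAbove
  have hzn : ∀ n, z n ≤ ζ := fun n => hζ ⟨n, rfl⟩
  have hζ0 : 0 < ζ := (hz0 0).trans_le (hzn 0)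
  set δ := min (c / 2) (ζ * (u₀ / 2)) with hδ
  have hδ0 : 0 < δ := lt_min (by positivity) (by positivity)
  have hδc : 2 * δ ≤ c := by linarith [min_le_left (c / 2) (ζ * (u₀ / 2))]
  set r := δ ^ 2 / (2 * ζ) with hr
  have hr0 : 0 < r := by positivity
  have htail := sampleMean_exp_tail hX hζ0
    (fun n u hu => hlt n u (hu.trans (by linarith))) (fun n => (hz n).mono (hzn n)) hδ0
    (min_le_right _ _) le_rfl
  -- From some time on, the exponent `r f(t)` is at least `2`.
  obtain ⟨t₀, ht₀⟩ := eventually_atTop.1 (hfT.eventually_ge_atTop (2 / r))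
  have hsum : ∀ T : ℕ, ∑ t ∈ Finset.Icc 1 T, 2 * (t : ℝ) ^ (-(r * f t)) ≤ 2 * (2 + t₀) := by
    intro T
    rw [← Finset.mul_sum]
    refine mul_le_mul_of_nonneg_left ?_ (by norm_num)
    calc _ ≤ ∑ t ∈ Finset.Icc 1 T, ((t : ℝ) ^ (-(2 : ℝ)) + if t < t₀ then 1 else 0) := by
          refine Finset.sum_le_sum fun t ht => ?_
          have ht1 : (1 : ℝ) ≤ t := by exact_mod_cast (Finset.mem_Icc.1 ht).1
          split_ifs with hlt
          · have : (t : ℝ) ^ (-(r * f t)) ≤ 1 :=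
              Real.rpow_le_one_of_one_le_of_nonpos ht1
                (neg_nonpos.2 (mul_pos hr0 (hf0 t)).le)
            have : 0 ≤ (t : ℝ) ^ (-(2 : ℝ)) := by positivity
            linarith
          · rw [add_zero]
            refine Real.rpow_le_rpow_of_exponent_le ht1 (neg_le_neg ?_)
            have := ht₀ t (not_lt.1 hlt)
            rw [div_le_iff₀ hr0] at this
            linarith
      _ ≤ (1 + 1 / ((2 : ℝ) - 1)) + t₀ := by
          rw [Finset.sum_add_distrib]
          refine add_le_add (sum_rpow_neg_le (by norm_num) T) ?_
          rw [← Finset.sum_filter, Finset.sum_const, nsmul_eq_mul, mul_one]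
          have : (Finset.filter (fun t => t < t₀) (Finset.Icc 1 T)).card ≤ t₀ := by
            calc _ ≤ (Finset.range t₀).card := Finset.card_le_card fun t ht => by
                  simpa using (Finset.mem_filter.1 ht).2
              _ = t₀ := Finset.card_range _
          exact_mod_cast this
      _ = _ := by norm_num
  set E := |explLoss μ hMN X σ| with hE
  set W := M * N * stepLoss μ hMN X σ K * (2 * (2 + (t₀ : ℝ))) with hW
  have hL : 0 ≤ stepLoss μ hMN X σ K := stepLoss_nonneg hpos hK
  have hW0 : 0 ≤ W := by positivity
  set b := f 0 * Real.log 2 with hb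
  have hb0 : 0 < b := mul_pos (hf0 0) (Real.log_pos (by norm_num))
  refine ⟨E + (E + W) / b, fun A Y h T hT => ?_⟩
  rw [abs_of_nonneg (h.systemRegret_nonneg hX hσ hpos hK ho hR isEstimator_sampleMean T)]
  have hbT : b ≤ f T * Real.log T :=
    mul_le_mul (hf (Nat.zero_le T)) (Real.log_le_log (by norm_num) (by exact_mod_cast hT))
      (Real.log_pos (by norm_num)).le (hf0 T).le
  have h1 := h.systemRegret_le_of_exp_tail hX hσ hpos hK ho hR isEstimator_sampleMean hδc hgap'
    hr0.le htail hf (fun t => (hf0 t).le) T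
  have h2 : (⌈f T * Real.log T⌉₊ : ℝ) * explLoss μ hMN X σ ≤ (f T * Real.log T + 1) * E := by
    calc _ ≤ (⌈f T * Real.log T⌉₊ : ℝ) * E := by
          gcongr
          exact le_abs_self _
      _ ≤ _ := by
          gcongr
          exact (Nat.ceil_lt_add_one (hb0.le.trans hbT)).le
  have h3 : M * N * stepLoss μ hMN X σ K * ∑ t ∈ Finset.Icc 1 T, 2 * (t : ℝ) ^ (-(r * f t)) ≤ W :=
    mul_le_mul_of_nonneg_left (hsum T) (by positivity)
  have h4 : E + W ≤ (E + W) / b * (f T * Real.log T) := by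
    rw [div_mul_eq_mul_div, le_div_iff₀ hb0]
    exact mul_le_mul_of_nonneg_left hbT (by positivity)
  linarith

/-- Regret of order `T^α`, `α = heavyExponent p`, under a finite `p`-th moment. -/
theorem exists_regret_le_of_heavyTail (hX : IsRewardProcess μ X)
    (hσ : Antitone (armMean μ X ∘ σ))
    (hpos : ∀ k : Fin M, 0 < armMean μ X (σ (Fin.castLE hMN k))) (hK : 0 ≤ K)
    (ho : Function.Injective o) (hR : IsRankingRule R) {p v : ℝ} (hp : 1 < p) (hv : 0 < v)
    (hpi : ∀ n, Integrable (fun ω => |X n 1 ω| ^ p) μ)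
    (hgap : IsBelowGap M (armMean μ X) σ 0 sch) :
    ∃ C : ℝ, ∀ A Y, IsPlay X
      (policy hMN sch o ρ R (fun t => v * (t : ℝ) ^ heavyExponent p) sampleMean) K A Y →
      ∀ T : ℕ, 1 ≤ T → |systemRegret μ hMN X σ Y T| ≤ C * (T : ℝ) ^ heavyExponent p := by
  obtain ⟨hα0, hα1, hαp⟩ := heavyExponent_bounds hp
  set α := heavyExponent p with hα
  obtain ⟨c, hc0, hgap'⟩ := hgap.exists_pos
  have hδ0 : 0 < c / 2 := by positivity
  choose C' hC' using fun n => sampleMean_heavyTail (hX.isIIDSeq n) hp (hpi n) hδ0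
  obtain ⟨C₀, hC₀⟩ := (Set.finite_range C').bddAbove
  set C := max C₀ 0 with hC
  have hC0 : 0 ≤ C := le_max_right _ _
  have hCn : ∀ n, C' n ≤ C := fun n => (hC₀ ⟨n, rfl⟩).trans (le_max_left _ _)
  have hN : (0 : ℝ) < N := by exact_mod_cast Nat.pos_of_ne_zero (NeZero.ne N)
  set B := C * (1 + (v / N) ^ (1 - p)) with hB
  have hB0 : 0 ≤ B := by positivity
  set E := |explLoss μ hMN X σ| with hE
  have hL : 0 ≤ stepLoss μ hMN X σ K := stepLoss_nonneg hpos hK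
  refine ⟨(v + 2) * E + M * N * stepLoss μ hMN X σ K * (B / α), fun A Y h T hT => ?_⟩
  rw [abs_of_nonneg (h.systemRegret_nonneg hX hσ hpos hK ho hR isEstimator_sampleMean T)]
  have hT1 : (1 : ℝ) ≤ (T : ℝ) ^ α := Real.one_le_rpow (by exact_mod_cast hT) hα0.le
  set q := ⌈v * (T : ℝ) ^ α + 1⌉₊ with hq
  have hcard : (explSeq (fun t => v * (t : ℝ) ^ α) T).card ≤ N * q := by
    have h1 := card_explSeq_lt (D := fun t => v * (t : ℝ) ^ α) (T := T) (B := v * (T : ℝ) ^ α)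
      (fun t _ ht => by gcongr) (by positivity)
    have h2 : (explSeq (fun t => v * (t : ℝ) ^ α) T).card ≤ q := by
      exact_mod_cast (h1.le.trans (Nat.le_ceil _))
    exact h2.trans (Nat.le_mul_of_pos_left _ (Nat.pos_of_ne_zero (NeZero.ne N)))
  -- Since `τ + 1 ≥ v t^α / N`, the tail `C (τ+1)^(1-p)` of the sample mean is of order `t^(α-1)`.
  have h1 := h.systemRegret_le hX hσ hpos hK ho hR isEstimator_sampleMean
    (δ := c / 2) (by linarith) hgap' hcard (b := fun t => B * (t : ℝ) ^ (α - 1))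
    (fun t => by positivity) (fun t ht hD m n => by
      set τ := (obsTimes (fun t : ℕ => v * (t : ℝ) ^ α) o m n t).card with hτ
      have h2 : ((τ : ℝ) + 1) ^ (1 - p) ≤ (1 + (v / N) ^ (1 - p)) * (t : ℝ) ^ (α - 1) := by
        rcases ht.eq_or_lt with rfl | ht'
        · rw [Nat.cast_one, Real.one_rpow, mul_one]
          have h3 : ((τ : ℝ) + 1) ^ (1 - p) ≤ 1 :=
            Real.rpow_le_one_of_one_le_of_nonpos
              (by linarith [(Nat.cast_nonneg τ : (0 : ℝ) ≤ τ)]) (by linarith)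
          have h4 : 0 ≤ (v / N) ^ (1 - p) := by positivity
          linarith
        · have ht0 : (0 : ℝ) < t := by exact_mod_cast ht
          have h3 : v / N * (t : ℝ) ^ α ≤ τ + 1 := by
            have h4 := le_card_obsTimes_of_notMem o m n (q := ⌊v / N * (t : ℝ) ^ α⌋₊) ht' hD (by
              have := Nat.floor_le (show 0 ≤ v / N * (t : ℝ) ^ α by positivity)
              calc (N : ℝ) * ⌊v / N * (t : ℝ) ^ α⌋₊ ≤ N * (v / N * (t : ℝ) ^ α) := by gcongr
                _ = _ := by field_simp)
            refine (Nat.lt_floor_add_one _).le.trans ?_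
            have : ((⌊v / N * (t : ℝ) ^ α⌋₊ : ℕ) : ℝ) ≤ τ := by exact_mod_cast h4
            linarith
          calc _ ≤ (v / N * (t : ℝ) ^ α) ^ (1 - p) :=
                Real.rpow_le_rpow_of_nonpos (by positivity) h3 (by linarith)
            _ = (v / N) ^ (1 - p) * (t : ℝ) ^ (α * (1 - p)) := by
                rw [Real.mul_rpow (by positivity) (by positivity), ← Real.rpow_mul ht0.le]
            _ ≤ (1 + (v / N) ^ (1 - p)) * (t : ℝ) ^ (α - 1) := by
                refine mul_le_mul (by linarith) ?_ (by positivity) (by positivity)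
                exact Real.rpow_le_rpow_of_exponent_le (by exact_mod_cast ht) (by linarith)
      calc _ ≤ C' n * ((τ : ℝ) + 1) ^ (1 - p) := hC' n _
        _ ≤ C * ((1 + (v / N) ^ (1 - p)) * (t : ℝ) ^ (α - 1)) := by
            refine mul_le_mul (hCn n) h2 (by positivity) hC0
        _ = _ := by rw [hB]; ring)
  rw [← Finset.mul_sum] at h1
  have h2 : (q : ℝ) * explLoss μ hMN X σ ≤ (v + 2) * (T : ℝ) ^ α * E := by
    calc _ ≤ (q : ℝ) * E := by
          gcongr
          exact le_abs_self _
      _ ≤ _ := by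
          gcongr
          have := (Nat.ceil_lt_add_one (show 0 ≤ v * (T : ℝ) ^ α + 1 by positivity)).le
          rw [← hq] at this
          linarith
  have h3 : M * N * stepLoss μ hMN X σ K * (B * ∑ t ∈ Finset.Icc 1 T, (t : ℝ) ^ (α - 1)) ≤
      M * N * stepLoss μ hMN X σ K * (B * ((T : ℝ) ^ α / α)) := by
    gcongr
    exact sum_rpow_sub_one_le hα0 hα1 T
  calc _ ≤ _ := h1
    _ ≤ _ := add_le_add h2 h3
    _ = _ := by ring

end Regret

end DSEE

theorem theorem7 {Ω : Type*} [MeasurableSpace Ω] (μ : Measure Ω) [IsProbabilityMeasure μ]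
    (N M : ℕ) [NeZero N] (hMN : M ≤ N)
    (X : Fin N → ℕ → Ω → ℝ) (hX : DSEE.IsRewardProcess μ X)
    (σ : Equiv.Perm (Fin N)) (hσ : Antitone (DSEE.armMean μ X ∘ σ))
    (hpos : ∀ k : Fin M, 0 < DSEE.armMean μ X (σ (Fin.castLE hMN k)))
    (K : ℝ) (hK : 0 ≤ K)
    (sch : DSEE.Scheme) (o : Fin M → Fin N) (ho : Function.Injective o)
    (ρ : ℕ → Equiv.Perm (Fin M))
    (R : ℕ → Fin M → (Fin N → ℝ) → Equiv.Perm (Fin N)) (hR : DSEE.IsRankingRule R) :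
    -- light tails, known constants: logarithmic regret
    (∀ u₀ ζ a c δ w : ℝ, 0 < u₀ → 0 < ζ →
      (∀ n, DSEE.IsLightTailedOn μ (X n 1) u₀) →
      (∀ n, DSEE.IsMgfCurvatureBound μ (X n 1) u₀ ζ) →
      0 < a → a ≤ 1 / (2 * ζ) →
      0 < c → DSEE.IsBelowGap M (DSEE.armMean μ X) σ c sch →
      δ = min (c / 2) (ζ * u₀) → 1 / (a * δ ^ 2) < w →
      ∀ A Y, DSEE.IsPlay X
        (DSEE.policy hMN sch o ρ R (fun t => N * ⌈w * Real.log t⌉₊) DSEE.sampleMean) K A Y →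
      ∀ T : ℕ, 1 ≤ T → DSEE.systemRegret μ hMN X σ Y T ≤
        ⌈w * Real.log T⌉₊ * DSEE.explLoss μ hMN X σ
          + 2 * M * N * DSEE.stepLoss μ hMN X σ K * (1 + 1 / (a * δ ^ 2 * w - 1))) ∧
    -- light tails, no knowledge of constants: regret arbitrarily close to logarithmic
    (∀ f : ℕ → ℝ, (∃ u₀ : ℝ, 0 < u₀ ∧ ∀ n, DSEE.IsLightTailedOn μ (X n 1) u₀) →
      DSEE.IsBelowGap M (DSEE.armMean μ X) σ 0 sch →
      (∀ t, 0 < f t) → Monotone f → Tendsto f atTop atTop →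
      ∃ C : ℝ, ∀ A Y, DSEE.IsPlay X
        (DSEE.policy hMN sch o ρ R (fun t => N * ⌈f t * Real.log t⌉₊) DSEE.sampleMean) K A Y →
      ∀ T : ℕ, 2 ≤ T → |DSEE.systemRegret μ hMN X σ Y T| ≤ C * (f T * Real.log T)) ∧
    -- heavy tails, finite moment of order `p > 1`: sublinear regret
    (∀ p v : ℝ, 1 < p → 0 < v →
      (∀ n, Integrable (fun ω => |X n 1 ω| ^ p) μ) →
      DSEE.IsBelowGap M (DSEE.armMean μ X) σ 0 sch →
      ∃ C : ℝ, ∀ A Y, DSEE.IsPlay X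
        (DSEE.policy hMN sch o ρ R (fun t => v * (t : ℝ) ^ DSEE.heavyExponent p)
          DSEE.sampleMean) K A Y →
      ∀ T : ℕ, 1 ≤ T →
        |DSEE.systemRegret μ hMN X σ Y T| ≤ C * (T : ℝ) ^ DSEE.heavyExponent p) ∧
    -- heavy tails, known moment bound, truncated sample means: logarithmic regret
    (∀ p u a δ w : ℝ, 1 < p → p ≤ 2 → 0 < u →
      (∀ n, Integrable (fun ω => |X n 1 ω| ^ p) μ) →
      (∀ n, ∫ ω, |X n 1 ω| ^ p ∂μ ≤ u) →
      a = (4 : ℝ) ^ (p / (1 - p)) * u ^ (1 / (1 - p)) →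
      0 < δ → DSEE.IsBelowGap M (DSEE.armMean μ X) σ (2 * δ) sch →
      1 / (a * δ ^ (p / (p - 1))) < w →
      ∀ A Y, DSEE.IsPlay X
        (DSEE.policy hMN sch o ρ R (fun t => N * ⌈w * Real.log t⌉₊)
          (DSEE.truncMean p u a δ)) K A Y →
      ∀ T : ℕ, 1 ≤ T → DSEE.systemRegret μ hMN X σ Y T ≤
        ⌈w * Real.log T⌉₊ * DSEE.explLoss μ hMN X σ
          + 2 * M * N * DSEE.stepLoss μ hMN X σ K
            * (1 + 1 / (a * δ ^ (p / (p - 1)) * w - 1))) := by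
  refine ⟨?_, ?_, ?_, ?_⟩
  · intro u₀ ζ a c δ w hu₀ hζ hlt hcurv ha haζ hc hgap hδ hw A Y h T _
    have hδ0 : 0 < δ := hδ ▸ lt_min (by positivity) (by positivity)
    have hδc : 2 * δ ≤ c := by linarith [min_le_left (c / 2) (ζ * u₀)]
    have hr : a * δ ^ 2 ≤ δ ^ 2 / (2 * ζ) := by
      calc a * δ ^ 2 ≤ 1 / (2 * ζ) * δ ^ 2 := by gcongr
        _ = _ := by ring
    exact h.systemRegret_le_log hX hσ hpos hK ho hR DSEE.isEstimator_sampleMean hδc hgap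
      (by positivity) hw
      (DSEE.sampleMean_exp_tail hX hζ hlt hcurv hδ0 (hδ ▸ min_le_right _ _) hr) T
  · rintro f ⟨u₀, hu₀, hlt⟩ hgap hf0 hf hfT
    exact DSEE.exists_regret_le_of_lightTail hX hσ hpos hK ho hR hu₀ hlt hgap hf0 hf hfT
  · intro p v hp hv hpi hgap
    exact DSEE.exists_regret_le_of_heavyTail hX hσ hpos hK ho hR hp hv hpi hgap
  · intro p u a δ w hp hp2 hu hpi hpu ha hδ hgap hw A Y h T _
    have ha0 : 0 < a := by rw [ha]; positivity
    exact h.systemRegret_le_log hX hσ hpos hK ho hR (DSEE.isEstimator_truncMean p u a δ) le_rfl hgap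
      (by positivity) hw
      (fun n S => DSEE.truncMean_concentration (hX.isIIDSeq n) hp hp2 hu (hpi n) (hpu n) ha hδ S) T
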